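/- Let $(\mathcal M,\tau)$ be a finite von Neumann algebra on a complex Hilbert space, with a faithful normal tracial state $\tau$. Let $L_1(\mathcal M)$, $L_2(\mathcal M)$ be the completions of $\mathcal M$ for $\|x\|_p=\tau(|x|^p)^{1/p}$. Let $\Phi:\mathbf R_+\to\mathbf R_+$ be convex and increasing with $\Phi(0)=0$ and $\Phi(t)\to\infty$ as $t\to\infty$, and let $L_\Phi(\mathcal M)\subset L_1(\mathcal M)$ be the Orlicz space of all $f$ with $\tau(\Phi(|f|/\lambda))<\infty$ for some $\lambda>0$, with norm $\|f\|_\Phi=\inf\{\lambda>0:\tau(\Phi(|f|/\lambda))\le 1\}$. For a sequence $(f_n)$ in $L_1(\mathcal M)$ put $$\|(f_n)_n\|_{L_1[\ell_\infty]}=\inf\Big\{\|\alpha\|_2\,\sup_n\|h_n\|_\infty\,\|\beta\|_2\;:\; f_n=\alpha h_n\beta,\ \alpha,\beta\in L_2(\mathcal M),\ h_n\in\mathcal M\Big\}\in[0,\infty],$$ $$\Big\|{\limsup_n}^{+}f_n\Big\|_1=\sup_{\varepsilon>0}\ \inf_{e}\ \inf_{N}\ \big\|(e^\perp f_n e^\perp)_{n>N}\big\|_{L_1[\ell_\infty]}\in[0,\infty],$$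 where, for each $\varepsilon$, $e$ runs over the projections of $\mathcal M$ with $\tau(e)<\varepsilon$, and $e^\perp=1-e$. One says that $f_n\to f$ bilaterally almost uniformly (b.a.u.) if for every $\varepsilon>0$ there is a projection $e\in\mathcal M$ with $\tau(e)<\varepsilon$ and $\|e^\perp(f_n-f)e^\perp\|_\infty\to0$, where $\|\cdot\|_\infty$ is the norm of $\mathcal M$ ($=\infty$ outside $\mathcal M$). Proposition. Let $S_n:L_1(\mathcal M)\to L_1(\mathcal M)$, $n\in\mathbf N$, be linear operators with $\sup_n\|S_n\|<\infty$. Assume that (i) there are a bounded normal linear operator $F:\mathcal M\to\mathcal M$ and a set $\mathcal S\subset\mathcal M$, dense in $L_\Phi(\mathcal M)$, such that $\|S_n(f)-F(f)\|_\infty\to0$ for every $f\in\mathcal S$; (ii) there is a constant $C$ such that $\big\|{\limsup_n}^{+}S_n(f)\big\|_1\le C\,\|f\|_\Phi$ for every $f\in L_\Phi(\mathcal M)$. Then there is exactly one bounded linear operator on $L_1(\mathcal M)$ that agrees with $F$ on $\mathcal S$ (so it is the continuous extension of $F$ to $L_1(\mathcal M)$ whenever $F$ has one); denoting it again by $F$,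 $S_n(f)\to F(f)$ b.a.u. for every $f\in L_\Phi(\mathcal M)$. -/

import Mathlib

open Filter Topology
open scoped NNReal ENNReal ComplexOrder InnerProductSpace

/-! ### A von Neumann algebra as a C*-algebra with its usual order -/

theorem exists_star_mul_self_of_spectrum {A : Type*} [CStarAlgebra A] {a : A}
    (ha : IsSelfAdjoint a) (h : ∀ r ∈ spectrum ℝ a, 0 ≤ r) : ∃ s : A, a = star s * s := by
  let := CStarAlgebra.spectralOrder A
  have := CStarAlgebra.spectralOrderedRing A
  have h0 : 0 ≤ a := (StarOrderedRing.nonneg_iff_spectrum_nonneg (R := ℝ) a ha).mpr h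
  exact CStarAlgebra.nonneg_iff_eq_star_mul_self.mp h0

section VN

variable {H : Type*} [NormedAddCommGroup H] [InnerProductSpace ℂ H] [CompleteSpace H]

instance VonNeumannAlgebra.isClosed_toStarSubalgebra (M : VonNeumannAlgebra H) :
    IsClosed (M.toStarSubalgebra : Set (H →L[ℂ] H)) := by
  have := M.centralizer_centralizer
  rw [VonNeumannAlgebra.coe_toStarSubalgebra, ← this]
  exact Set.isClosed_centralizer _

/-- The order inherited from `B(H)` is the order given by the cone of the elements `s⋆ s`, with
`s` in the algebra. -/
instance VonNeumannAlgebra.starOrderedRing (M : VonNeumannAlgebra H) :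
    StarOrderedRing M.toStarSubalgebra := by
  refine StarOrderedRing.of_nonneg_iff' (fun {x y} hxy z => ?_) (fun x => ?_)
  · exact add_le_add_right (α := H →L[ℂ] H) hxy z
  · constructor
    · intro hx
      have hx' : (0 : H →L[ℂ] H) ≤ (x : H →L[ℂ] H) := hx
      have hsa : IsSelfAdjoint x := Subtype.ext (IsSelfAdjoint.of_nonneg hx').star_eq
      refine exists_star_mul_self_of_spectrum hsa (fun r hr => ?_)
      have hr' : algebraMap ℝ ℂ r ∈ spectrum ℂ x := by
        rwa [spectrum.algebraMap_mem_iff]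
      rw [StarSubalgebra.spectrum_eq] at hr'
      exact spectrum_nonneg_of_nonneg hx' ((spectrum.algebraMap_mem_iff ℂ).mp hr')
    · rintro ⟨s, rfl⟩
      exact star_mul_self_nonneg (s : H →L[ℂ] H)

/-- The algebra `M` as a type of its own, with its structure of C*-algebra and its order. -/
def VonNeumannAlgebra.Elem (M : VonNeumannAlgebra H) : Type _ := M.toStarSubalgebra

noncomputable instance (M : VonNeumannAlgebra H) : CStarAlgebra M.Elem :=
  inferInstanceAs (CStarAlgebra M.toStarSubalgebra)

noncomputable instance (M : VonNeumannAlgebra H) : PartialOrder M.Elem :=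
  inferInstanceAs (PartialOrder M.toStarSubalgebra)

instance (M : VonNeumannAlgebra H) : StarOrderedRing M.Elem :=
  inferInstanceAs (StarOrderedRing M.toStarSubalgebra)

/-- The inclusion of `M` in `B(H)`. -/
noncomputable def VonNeumannAlgebra.incl (M : VonNeumannAlgebra H) : M.Elem →⋆ₐ[ℂ] (H →L[ℂ] H) :=
  M.toStarSubalgebra.subtype

theorem VonNeumannAlgebra.norm_incl (M : VonNeumannAlgebra H) (x : M.Elem) : ‖M.incl x‖ = ‖x‖ := rfl

/-- A functional on `M` is normal (that is, weak-⋆ continuous, or: it belongs to the predual `M_*`)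
iff it has the form `x ↦ ∑ᵢ ⟪ηᵢ, x ξᵢ⟫` with `∑ᵢ ‖ξᵢ‖² < ∞` and `∑ᵢ ‖ηᵢ‖² < ∞`. -/
def VonNeumannAlgebra.IsNormalFunctional (M : VonNeumannAlgebra H)
    (φ : StrongDual ℂ M.Elem) : Prop :=
  ∃ ξ η : ℕ → H, (Summable fun i => ‖ξ i‖ ^ 2) ∧ (Summable fun i => ‖η i‖ ^ 2) ∧
    ∀ x : M.Elem, HasSum (fun i => ⟪η i, M.incl x (ξ i)⟫_ℂ) (φ x)

/-- A bounded operator `F : M → M` is normal (weak-⋆ continuous) iff composition with `F` maps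
weak-⋆ continuous functionals to weak-⋆ continuous functionals. -/
def VonNeumannAlgebra.IsNormalMap (M : VonNeumannAlgebra H)
    (F : M.Elem →L[ℂ] M.Elem) : Prop :=
  ∀ φ : StrongDual ℂ M.Elem, M.IsNormalFunctional φ → M.IsNormalFunctional (φ.comp F)

/-- A positive functional `τ` is a normalized, faithful, normal trace on `M`; the pair `(M, τ)` is
a finite von Neumann algebra with its (normalized) trace. -/
structure VonNeumannAlgebra.IsFaithfulNormalTracialState (M : VonNeumannAlgebra H)
    (τ : M.Elem →ₚ[ℂ] ℂ) : Prop where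
  map_one : τ 1 = 1
  map_mul_comm : ∀ x y, τ (x * y) = τ (y * x)
  faithful : ∀ x, 0 ≤ x → τ x = 0 → x = 0
  normal : M.IsNormalFunctional ⟨τ.toLinearMap, map_continuous τ⟩

end VN

/-! ### Noncommutative integration with respect to a trace -/

noncomputable section

namespace NCInt

variable {A : Type*} [CStarAlgebra A] [PartialOrder A] [StarOrderedRing A]

/-- The embedding `y ↦ τ(y ·)` of the algebra in its dual. For a trace `τ`, the dual norm of the
functional `τ(y ·)` is `τ(|y|)`. -/
def embed (τ : A →ₚ[ℂ] ℂ) : A →L[ℂ] StrongDual ℂ A :=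
  (ContinuousLinearMap.compL ℂ A A ℂ ⟨τ.toLinearMap, map_continuous τ⟩).comp (ContinuousLinearMap.mul ℂ A)

theorem embed_apply (τ : A →ₚ[ℂ] ℂ) (y x : A) : embed τ y x = τ (y * x) := rfl

/-- The closure, in the dual of the algebra, of the functionals `τ(y ·)`. -/
def L1Submodule (τ : A →ₚ[ℂ] ℂ) : Submodule ℂ (StrongDual ℂ A) :=
  (LinearMap.range (embed τ : A →ₗ[ℂ] StrongDual ℂ A)).topologicalClosure

/-- `L₁(A, τ)`, the completion of the algebra with respect to the norm `‖y‖₁ = τ(|y|)`, realized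
inside the dual of the algebra: `f ∈ L₁` is the functional `τ(f ·)`. (When the algebra is a
von Neumann algebra and `τ` is a faithful normal trace on it, this is its predual.) -/
def L1 (τ : A →ₚ[ℂ] ℂ) : Type _ := L1Submodule τ

instance (τ : A →ₚ[ℂ] ℂ) : NormedAddCommGroup (L1 τ) :=
  inferInstanceAs (NormedAddCommGroup (L1Submodule τ))

instance (τ : A →ₚ[ℂ] ℂ) : NormedSpace ℂ (L1 τ) :=
  inferInstanceAs (NormedSpace ℂ (L1Submodule τ))

/-- The inclusion of `L₁` in the dual of the algebra, `f ↦ τ(f ·)`. -/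
def L1.toDual (τ : A →ₚ[ℂ] ℂ) : L1 τ →ₗᵢ[ℂ] StrongDual ℂ A := (L1Submodule τ).subtypeₗᵢ

/-- The inclusion of the algebra in `L₁`. -/
def toL1 (τ : A →ₚ[ℂ] ℂ) (y : A) : L1 τ :=
  ⟨embed τ y, Submodule.le_topologicalClosure _ ⟨y, rfl⟩⟩

/-- The bimodule action `f ↦ a f b` of the algebra: `τ(a f b x) = τ(f b x a)`. -/
def bimul (a : A) (f : StrongDual ℂ A) (b : A) : StrongDual ℂ A :=
  f.comp (ContinuousLinearMap.mulLeftRight ℂ A b a)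

theorem bimul_embed (τ : A →ₚ[ℂ] ℂ) (hτ : ∀ x y, τ (x * y) = τ (y * x)) (a y b : A) :
    bimul a (embed τ y) b = embed τ (a * y * b) := by
  ext x
  change τ (y * (b * x * a)) = τ (a * y * b * x)
  rw [← mul_assoc, hτ]
  simp only [mul_assoc]

/-- `e^⊥ f e^⊥`, where `e^⊥ = 1 - e`. -/
def corner (e : A) (f : StrongDual ℂ A) : StrongDual ℂ A := bimul (1 - e) f (1 - e)

/-- The `L_∞` norm of a functional `f`: it is `‖y‖` when `f` is the element `y` of the
algebra, and `∞` when `f` does not belong to the algebra. -/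
def normInf (τ : A →ₚ[ℂ] ℂ) (f : StrongDual ℂ A) : ℝ≥0∞ :=
  ⨅ (y : A) (_ : embed τ y = f), ‖y‖ₑ

/-! #### `L₂` and the product `L₂ · A · L₂ → L₁`

`L₂(A, τ)` is the Hilbert space `τ.GNS`, the completion of the algebra with respect to
`⟪x, y⟫ = τ(x⋆ y)`. -/

/-- The inclusion of the algebra in `L₂`. -/
def toL2 (τ : A →ₚ[ℂ] ℂ) (a : A) : τ.GNS := (τ.toPreGNS a : τ.GNS)

/-- The involution `a ↦ a⋆` of the algebra, with values in `L₂`. -/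
def starAux (τ : A →ₚ[ℂ] ℂ) : τ.PreGNS →ₗ⋆[ℂ] τ.GNS where
  toFun a := toL2 τ (star (τ.ofPreGNS a))
  map_add' a b := by
    simp [toL2, UniformSpace.Completion.coe_add]
  map_smul' c a := by
    simp [toL2, UniformSpace.Completion.coe_smul]

/-- The involution `α ↦ α⋆` of `L₂`, as the continuous extension of the one of the algebra. -/
def starL2 (τ : A →ₚ[ℂ] ℂ) : τ.GNS →L⋆[ℂ] τ.GNS :=
  (starAux τ).extendOfNorm
    (UniformSpace.Completion.toComplL (𝕜 := ℂ) (E := τ.PreGNS) : τ.PreGNS →ₗ[ℂ] τ.GNS)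

theorem norm_starAux (τ : A →ₚ[ℂ] ℂ) (hτ : ∀ x y, τ (x * y) = τ (y * x)) (a : τ.PreGNS) :
    ‖starAux τ a‖ = ‖a‖ := by
  change ‖((τ.toPreGNS (star (τ.ofPreGNS a)) : τ.PreGNS) : τ.GNS)‖ = ‖a‖
  rw [UniformSpace.Completion.norm_coe, τ.preGNS_norm_def, τ.preGNS_norm_def]
  simp [hτ (τ.ofPreGNS a)]

theorem starL2_toL2 (τ : A →ₚ[ℂ] ℂ) (hτ : ∀ x y, τ (x * y) = τ (y * x)) (a : A) :
    starL2 τ (toL2 τ a) = toL2 τ (star a) :=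
  LinearMap.extendOfNorm_eq (f := starAux τ)
    (e := (UniformSpace.Completion.toComplL (𝕜 := ℂ) (E := τ.PreGNS) : τ.PreGNS →ₗ[ℂ] τ.GNS))
    UniformSpace.Completion.denseRange_coe
    ⟨1, fun x => by
      rw [norm_starAux τ hτ, one_mul]
      exact (UniformSpace.Completion.norm_coe x).ge⟩ (τ.toPreGNS a)

/-- The left multiplication `(h, α) ↦ h α` of `A` on `L₂`, as a map `h ↦ h α`. -/
def leftMul (τ : A →ₚ[ℂ] ℂ) (α : τ.GNS) : A →L[ℂ] τ.GNS :=
  LinearMap.mkContinuous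
    { toFun := fun h => τ.gnsStarAlgHom h α
      map_add' := fun h k => by simp
      map_smul' := fun c h => by simp }
    ‖α‖ (fun h => by
      have h1 := (τ.gnsStarAlgHom h).le_opNorm α
      have h2 := NonUnitalStarAlgHom.norm_apply_le τ.gnsStarAlgHom h
      calc ‖τ.gnsStarAlgHom h α‖ ≤ ‖τ.gnsStarAlgHom h‖ * ‖α‖ := h1
        _ ≤ ‖h‖ * ‖α‖ := by gcongr
        _ = ‖α‖ * ‖h‖ := mul_comm _ _)

theorem leftMul_toL2 (τ : A →ₚ[ℂ] ℂ) (h a : A) : leftMul τ (toL2 τ a) h = toL2 τ (h * a) := by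
  change τ.gnsStarAlgHom h (τ.toPreGNS a : τ.GNS) = _
  exact τ.gnsNonUnitalStarAlgHom_apply_coe

/-- The product `α h β ∈ L₁` of `α, β ∈ L₂` and `h` in the algebra, as the functional
`x ↦ τ(α h β x) = τ((x α) (h β)) = ⟪(x α)⋆, h β⟫`. -/
def triple (τ : A →ₚ[ℂ] ℂ) (α : τ.GNS) (h : A) (β : τ.GNS) : StrongDual ℂ A :=
  (((innerSL ℂ).flip (leftMul τ β h)).comp (starL2 τ)).comp (leftMul τ α)

theorem triple_toL2 (τ : A →ₚ[ℂ] ℂ) (hτ : ∀ x y, τ (x * y) = τ (y * x)) (a h b : A) :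
    triple τ (toL2 τ a) h (toL2 τ b) = embed τ (a * h * b) := by
  ext x
  change ⟪starL2 τ (leftMul τ (toL2 τ a) x), leftMul τ (toL2 τ b) h⟫_ℂ = τ (a * h * b * x)
  rw [leftMul_toL2, leftMul_toL2, starL2_toL2 τ hτ, toL2, toL2, UniformSpace.Completion.inner_coe,
    τ.preGNS_inner_def, hτ (a * h * b) x]
  simp [mul_assoc]

/-! #### Maximal norms -/

/-- The norm of `(f n)ₙ` in `L₁(A; ℓ_∞)`: the infimum of `‖α‖₂ (sup_n ‖h n‖_∞) ‖β‖₂` over all the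
factorizations `f n = α (h n) β` with `α, β ∈ L₂`. It is `∞` iff there is no such factorization
with a bounded sequence `h`. -/
def normL1linf (τ : A →ₚ[ℂ] ℂ) (f : ℕ → StrongDual ℂ A) : ℝ≥0∞ :=
  ⨅ (α : τ.GNS) (β : τ.GNS) (h : ℕ → A) (_ : ∀ n, f n = triple τ α (h n) β),
    ‖α‖ₑ * (⨆ n, ‖h n‖ₑ) * ‖β‖ₑ

/-- `‖limsup⁺ f n‖₁ = sup_{ε > 0} inf_{τ(e) < ε} inf_N ‖(e^⊥ (f n) e^⊥)_{n > N}‖_{L₁[ℓ_∞]}`. -/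
def limsupNorm (τ : A →ₚ[ℂ] ℂ) (f : ℕ → StrongDual ℂ A) : ℝ≥0∞ :=
  ⨆ (ε : ℝ) (_ : 0 < ε), ⨅ (e : A) (_ : IsStarProjection e) (_ : (τ e).re < ε) (N : ℕ),
    normL1linf τ (fun k => corner e (f (N + 1 + k)))

/-- Bilateral almost uniform convergence. -/
def TendstoBAU (τ : A →ₚ[ℂ] ℂ) (f : ℕ → StrongDual ℂ A) (g : StrongDual ℂ A) : Prop :=
  ∀ ε : ℝ, 0 < ε → ∃ e : A, IsStarProjection e ∧ (τ e).re < ε ∧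
    Tendsto (fun n => normInf τ (corner e (f n - g))) atTop (𝓝 0)

/-! #### Orlicz spaces -/

/-- The functions `Φ` that define Orlicz spaces: convex, increasing, vanishing at `0` and
tending to `∞` at `∞`. -/
structure IsOrliczFunction (Φ : ℝ≥0 → ℝ≥0) : Prop where
  convexOn : ConvexOn ℝ≥0 Set.univ Φ
  monotone : Monotone Φ
  map_zero : Φ 0 = 0
  tendsto_atTop : Tendsto Φ atTop atTop

/-- `τ(Φ(|y|))` for `y` in the algebra, by continuous functional calculus. -/
def modularAlg (τ : A →ₚ[ℂ] ℂ) (Φ : ℝ≥0 → ℝ≥0) (y : A) : ℝ≥0∞ :=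
  ENNReal.ofReal (τ (cfc (fun s : ℝ => (Φ s.toNNReal : ℝ)) (CFC.abs y))).re

/-- `τ(Φ(|f|))` for `f ∈ L₁`: the supremum of `τ(Φ(|f e|))` over all projections `e` for which the
cut-down `f e` belongs to the algebra. (The supremum is attained at `e = 1` when `f` belongs to the
algebra; in general it is the limit along the spectral projections `e = 1_{[0, n]}(|f|)`, for which
`|f e| = |f| 1_{[0, n]}(|f|)`.) -/
def modular (τ : A →ₚ[ℂ] ℂ) (Φ : ℝ≥0 → ℝ≥0) (f : StrongDual ℂ A) : ℝ≥0∞ :=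
  ⨆ (e : A) (_ : IsStarProjection e) (y : A) (_ : embed τ y = bimul 1 f e), modularAlg τ Φ y

/-- `L_Φ(A, τ)`: those `f` with `τ(Φ(|f| / r)) < ∞` for some `r > 0`. As `Φ` grows at least linearly
and `τ` is finite, it is contained in `L₁`. -/
def LPhi (τ : A →ₚ[ℂ] ℂ) (Φ : ℝ≥0 → ℝ≥0) : Set (L1 τ) :=
  {f | ∃ r : ℝ≥0, 0 < r ∧ modular τ Φ (L1.toDual τ (((r : ℝ) : ℂ)⁻¹ • f)) < ∞}

/-- The (Luxemburg) norm of `L_Φ`: `inf {r : τ(Φ(|f| / r)) ≤ 1}`. -/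
def normPhi (τ : A →ₚ[ℂ] ℂ) (Φ : ℝ≥0 → ℝ≥0) (f : L1 τ) : ℝ≥0∞ :=
  ⨅ (r : ℝ≥0) (_ : 0 < r) (_ : modular τ Φ (L1.toDual τ (((r : ℝ) : ℂ)⁻¹ • f)) ≤ 1), (r : ℝ≥0∞)

end NCInt

end

section CStar

variable {A : Type*} [CStarAlgebra A] [PartialOrder A] [StarOrderedRing A]

theorem exists_resolvent {b : A} (hb : 0 ≤ b) {δ : ℝ} (hδ : 0 < δ) :
    ∃ y : A, 0 ≤ y ∧ y * b = b * y ∧ b * y + δ • y = 1 ∧ δ • y ≤ 1 := by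
  have hsp : ∀ x ∈ spectrum ℝ b, 0 ≤ x := fun x hx => spectrum_nonneg_of_nonneg hb hx
  have hc : ContinuousOn (fun t : ℝ => (t + δ)⁻¹) (spectrum ℝ b) := by
    refine ContinuousOn.inv₀ (by fun_prop) fun x hx => ?_
    have := hsp x hx
    positivity
  have hsa : IsSelfAdjoint b := IsSelfAdjoint.of_nonneg hb
  have hsum : b * cfc (fun t : ℝ => (t + δ)⁻¹) b + δ • cfc (fun t : ℝ => (t + δ)⁻¹) b = 1 := by
    nth_rewrite 1 [← cfc_id' ℝ b]
    rw [← cfc_mul (fun t : ℝ => t) (fun t : ℝ => (t + δ)⁻¹) b,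
      ← cfc_smul δ (fun t : ℝ => (t + δ)⁻¹) b hc,
      ← cfc_add (a := b) (fun t : ℝ => t * (t + δ)⁻¹)
        (fun t : ℝ => δ • (t + δ)⁻¹) (continuousOn_id.mul hc) (hc.const_smul δ),
      ← cfc_one ℝ b]
    refine cfc_congr fun x hx => ?_
    have := hsp x hx
    simp only [smul_eq_mul, Pi.one_apply]
    field_simp
  have hcomm : cfc (fun t : ℝ => (t + δ)⁻¹) b * b = b * cfc (fun t : ℝ => (t + δ)⁻¹) b :=
    ((Commute.refl b).cfc_real (fun t : ℝ => (t + δ)⁻¹)).eq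
  have hle : cfc (fun t : ℝ => (t + δ)⁻¹) b ≤ algebraMap ℝ A δ⁻¹ := by
    refine cfc_le_algebraMap _ _ b (fun x hx => ?_) hc
    have := hsp x hx
    gcongr
    linarith
  refine ⟨cfc (fun t : ℝ => (t + δ)⁻¹) b, cfc_nonneg fun x hx => ?_, hcomm, hsum, ?_⟩
  · have := hsp x hx
    positivity
  · calc δ • cfc (fun t : ℝ => (t + δ)⁻¹) b ≤ δ • algebraMap ℝ A δ⁻¹ :=
        smul_le_smul_of_nonneg_left hle hδ.le
      _ = 1 := by rw [Algebra.algebraMap_eq_smul_one, smul_smul, mul_inv_cancel₀ hδ.ne', one_smul]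

theorem norm_le_of_nonneg_of_le_smul_one {a : A} {r : ℝ} (ha : 0 ≤ a) (hr : 0 ≤ r)
    (h : a ≤ r • (1 : A)) : ‖a‖ ≤ r := by
  rw [CStarAlgebra.norm_le_iff_le_algebraMap a hr ha, Algebra.algebraMap_eq_smul_one]
  exact h

theorem IsStarProjection.norm_le_one {e : A} (he : IsStarProjection e) : ‖e‖ ≤ 1 :=
  (CStarAlgebra.norm_le_one_iff_of_nonneg e he.nonneg).2 he.le_one

/-- If `b` dominates a multiple `c p` of a projection, then `c (p b⁻¹ p) ≤ p`. -/
theorem smul_conjugate_resolvent_le {b p y : A} {c δ : ℝ} (hp : IsStarProjection p) (hc : 0 < c)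
    (hδ : 0 ≤ δ) (hbp : c • p ≤ b) (hy : 0 ≤ y) (h1 : b * y + δ • y = 1) :
    c • (p * y * p) ≤ p := by
  have hysa : IsSelfAdjoint y := IsSelfAdjoint.of_nonneg hy
  have hz : 0 ≤ p * y * p := by
    simpa [hp.isSelfAdjoint.star_eq] using star_left_conjugate_nonneg hy p
  have hyy : y * (c • p) * y ≤ y := by
    calc y * (c • p) * y ≤ y * b * y := by
          simpa [hysa.star_eq] using star_left_conjugate_le_conjugate hbp y
      _ ≤ y * b * y + δ • (y * y) := by
          refine le_add_of_nonneg_right (smul_nonneg hδ ?_)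
          simpa [hysa.star_eq] using star_mul_self_nonneg y
      _ = y * (b * y + δ • y) := by rw [mul_add, mul_smul_comm, mul_assoc]
      _ = y := by rw [h1, mul_one]
  have hzz : c • ((p * y * p) * (p * y * p)) ≤ p * y * p := by
    have := star_left_conjugate_le_conjugate hyy p
    rw [hp.isSelfAdjoint.star_eq] at this
    refine le_of_eq_of_le ?_ this
    simp only [mul_smul_comm, smul_mul_assoc, mul_assoc]
    rw [← mul_assoc p p, hp.isIdempotentElem.eq]
  have hn : c * ‖p * y * p‖ ≤ 1 := by
    have h2 := CStarAlgebra.norm_le_norm_of_nonneg_of_le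
      (smul_nonneg hc.le (by
        simpa [(IsSelfAdjoint.of_nonneg hz).star_eq] using star_mul_self_nonneg (p * y * p))) hzz
    have h3 : ‖(p * y * p) * (p * y * p)‖ = ‖p * y * p‖ * ‖p * y * p‖ := by
      simpa [(IsSelfAdjoint.of_nonneg hz).star_eq] using
        CStarRing.norm_star_mul_self (x := p * y * p)
    rw [norm_smul, h3, Real.norm_of_nonneg hc.le] at h2
    by_contra! h
    have : 0 < ‖p * y * p‖ := by
      by_contra! h0
      nlinarith [norm_nonneg (p * y * p)]
    nlinarith
  have h4 : c • (p * y * p) ≤ 1 := by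
    refine (CStarAlgebra.norm_le_one_iff_of_nonneg _ (smul_nonneg hc.le hz)).1 ?_
    rwa [norm_smul, Real.norm_of_nonneg hc.le]
  have h5 := star_left_conjugate_le_conjugate h4 p
  rw [hp.isSelfAdjoint.star_eq, mul_one, hp.isIdempotentElem.eq] at h5
  refine le_of_eq_of_le ?_ h5
  simp only [mul_smul_comm, smul_mul_assoc, mul_assoc]
  rw [hp.isIdempotentElem.eq, ← mul_assoc p p, hp.isIdempotentElem.eq]

end CStar

section Positive

variable {A : Type*} [CStarAlgebra A] [PartialOrder A]

theorem re_apply_mono (τ : A →ₚ[ℂ] ℂ) {a b : A} (h : a ≤ b) : (τ a).re ≤ (τ b).re :=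
  (Complex.le_def.1 (OrderHomClass.mono τ h)).1

theorem re_apply_nonneg (τ : A →ₚ[ℂ] ℂ) {a : A} (h : 0 ≤ a) : 0 ≤ (τ a).re :=
  (Complex.le_def.1 (τ.map_nonneg h)).1

theorem re_apply_smul (τ : A →ₚ[ℂ] ℂ) (r : ℝ) (a : A) : (τ (r • a)).re = r * (τ a).re := by
  rw [← Complex.coe_smul, map_smul]
  simp

end Positive

namespace VonNeumannAlgebra

variable {H : Type*} [NormedAddCommGroup H] [InnerProductSpace ℂ H] [CompleteSpace H]

/-- The projection onto the kernel of a self-adjoint element belongs to the algebra. -/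
theorem exists_kernel_projection (M : VonNeumannAlgebra H) (a : M.Elem) (ha : IsSelfAdjoint a) :
    ∃ q : M.Elem, IsStarProjection q ∧ a * q = 0 ∧ (∀ x, a * x = 0 → q * x = x) ∧
      ∀ ξ : H, ξ - M.incl q ξ ∈ closure (Set.range (M.incl a)) := by
  set T : H →L[ℂ] H := M.incl a
  have hT : IsSelfAdjoint T := by
    rw [IsSelfAdjoint, ← map_star, ha.star_eq]
  set K : Submodule ℂ H := T.ker
  have hK : IsClosed (K : Set H) := T.isClosed_ker
  have : CompleteSpace K := hK.completeSpace_coe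
  have hP : IsStarProjection K.starProjection := isStarProjection_starProjection
  have hmem : K.starProjection ∈ M := by
    rw [IsStarProjection.mem_iff hP]
    intro y hy
    rw [Module.End.mem_invtSubmodule]
    intro x hx
    have hx' : x ∈ K := by
      simpa [Submodule.range_starProjection] using hx
    have : y x ∈ K := by
      have hc : T * y = y * T := mem_commutant_iff.1 hy T a.2
      change T (y x) = 0
      have h1 : T (y x) = y (T x) := congr($hc x)
      have h2 : T x = 0 := hx'
      rw [h1, h2, map_zero]
    simpa [Submodule.range_starProjection] using this
  have hinj : Function.Injective M.incl := Subtype.val_injective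
  let q : M.Elem := ⟨K.starProjection, hmem⟩
  have hq : M.incl q = K.starProjection := rfl
  refine ⟨q, ⟨hinj ?_, hinj ?_⟩, hinj ?_, fun x hx => hinj ?_, fun ξ => ?_⟩
  · rw [map_mul, hq]
    exact hP.isIdempotentElem
  · rw [map_star, hq]
    exact hP.isSelfAdjoint
  · rw [map_mul, map_zero, hq]
    ext ξ
    exact (K.starProjection_apply_mem ξ : T _ = 0)
  · rw [map_mul, hq]
    ext ξ
    refine Submodule.starProjection_eq_self_iff.2 ?_
    have h1 : T * M.incl x = 0 := by rw [← map_mul, hx, map_zero]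
    exact congr($h1 ξ)
  · have h1 : ξ - M.incl q ξ ∈ Kᗮ := by
      rw [hq]
      exact K.sub_starProjection_mem_orthogonal ξ
    rw [ContinuousLinearMap.orthogonal_ker, ContinuousLinearMap.isSelfAdjoint_iff'.1 hT] at h1
    exact h1

/-- Chebyshev's inequality: the spectral projection of a positive element. -/
theorem exists_projection_norm_mul_le (M : VonNeumannAlgebra H) (τ : M.Elem →ₚ[ℂ] ℂ) {b : M.Elem}
    (hb : 0 ≤ b) {r : ℝ} (hr : 0 ≤ r) :
    ∃ e : M.Elem, IsStarProjection e ∧ r * (τ e).re ≤ (τ b).re ∧ ‖b * (1 - e)‖ ≤ r := by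
  have hbsa : IsSelfAdjoint b := IsSelfAdjoint.of_nonneg hb
  set a : M.Elem := b - r • (1 : M.Elem) with ha
  have hasa : IsSelfAdjoint a := hbsa.sub ((IsSelfAdjoint.all r).smul (IsSelfAdjoint.one _))
  have hpsa : IsSelfAdjoint a⁺ := IsSelfAdjoint.of_nonneg (CFC.posPart_nonneg a)
  have hnsa : IsSelfAdjoint a⁻ := IsSelfAdjoint.of_nonneg (CFC.negPart_nonneg a)
  have hsub : a⁺ - a⁻ = a := CFC.posPart_sub_negPart a hasa
  obtain ⟨q, hq, hpq, huniv, -⟩ := M.exists_kernel_projection a⁺ hpsa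
  have hqn : q * a⁻ = a⁻ := huniv _ (CFC.posPart_mul_negPart a)
  have hnq : a⁻ * q = a⁻ := by
    have := congr(star $hqn)
    rwa [star_mul, hnsa.star_eq, hq.isSelfAdjoint.star_eq] at this
  have hbq : b * q = r • q - a⁻ := by
    have h1 : b = a⁺ - a⁻ + r • 1 := by rw [hsub, ha]; abel
    rw [h1, add_mul, sub_mul, hpq, hnq, smul_mul_assoc, one_mul]
    abel
  refine ⟨1 - q, hq.one_sub, ?_, ?_⟩
  · have h1 : b = r • (1 - q) + a⁺ + b * q := by
      have h1 : b = a⁺ - a⁻ + r • 1 := by rw [hsub, ha]; abel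
      rw [hbq, smul_sub]
      nth_rewrite 1 [h1]
      abel
    have h2 : r • (1 - q) ≤ b := by
      have h3 : 0 ≤ b * q := by
        have h4 : b * q = star q * b * q := by
          rw [hq.isSelfAdjoint.star_eq, mul_assoc, hbq, mul_sub, mul_smul_comm,
            hq.isIdempotentElem.eq, hqn]
        rw [h4]
        exact star_left_conjugate_nonneg hb q
      refine le_of_le_of_eq ?_ h1.symm
      rw [add_assoc]
      exact le_add_of_nonneg_right (add_nonneg (CFC.posPart_nonneg a) h3)
    rw [← re_apply_smul]
    exact re_apply_mono τ h2
  · rw [sub_sub_cancel]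
    have h4 : b * q = star q * b * q := by
      rw [hq.isSelfAdjoint.star_eq, mul_assoc, hbq, mul_sub, mul_smul_comm,
        hq.isIdempotentElem.eq, hqn]
    refine norm_le_of_nonneg_of_le_smul_one ?_ hr ?_
    · rw [h4]
      exact star_left_conjugate_nonneg hb q
    · rw [hbq]
      exact (sub_le_self _ (CFC.negPart_nonneg a)).trans (smul_le_smul_of_nonneg_left hq.le_one hr)

/-- A normal functional is continuous for bounded strong convergence. -/
theorem IsNormalFunctional.tendsto {M : VonNeumannAlgebra H} {φ : StrongDual ℂ M.Elem}
    (hφ : M.IsNormalFunctional φ) {x : ℕ → M.Elem} {y : M.Elem} {C : ℝ} (hx : ∀ n, ‖x n‖ ≤ C)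
    (h : ∀ ξ, Tendsto (fun n => M.incl (x n) ξ) atTop (𝓝 (M.incl y ξ))) :
    Tendsto (fun n => φ (x n)) atTop (𝓝 (φ y)) := by
  obtain ⟨ξ, η, hξ, hη, hsum⟩ := hφ
  have h1 : ∀ z, φ z = ∑' i, ⟪η i, M.incl z (ξ i)⟫_ℂ := fun z => (hsum z).tsum_eq.symm
  simp_rw [h1]
  refine tendsto_tsum_of_dominated_convergence (bound := fun i => C * (‖ξ i‖ ^ 2 + ‖η i‖ ^ 2))
    ((hξ.add hη).mul_left C) (fun i => tendsto_const_nhds.inner (h (ξ i))) (Eventually.of_forall fun n i => ?_)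
  have hC : 0 ≤ C := (norm_nonneg _).trans (hx 0)
  calc ‖⟪η i, M.incl (x n) (ξ i)⟫_ℂ‖ ≤ ‖η i‖ * ‖M.incl (x n) (ξ i)‖ := norm_inner_le_norm _ _
    _ ≤ ‖η i‖ * (C * ‖ξ i‖) := by
        gcongr
        exact (M.incl (x n)).le_of_opNorm_le ((M.norm_incl _).trans_le (hx n)) _
    _ = C * (‖ξ i‖ * ‖η i‖) := by ring
    _ ≤ C * (‖ξ i‖ ^ 2 + ‖η i‖ ^ 2) := by
        gcongr
        nlinarith [sq_nonneg (‖ξ i‖ - ‖η i‖), sq_nonneg (‖ξ i‖), sq_nonneg (‖η i‖)]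

/-- A normal trace is countably subadditive on projections. -/
theorem IsFaithfulNormalTracialState.exists_projection_sup {M : VonNeumannAlgebra H}
    {τ : M.Elem →ₚ[ℂ] ℂ} (hτ : M.IsFaithfulNormalTracialState τ) {e : ℕ → M.Elem}
    (he : ∀ k, IsStarProjection (e k)) {t : ℕ → ℝ} {s : ℝ} (ht : HasSum t s)
    (het : ∀ k, (τ (e k)).re ≤ t k) :
    ∃ p : M.Elem, IsStarProjection p ∧ (∀ k, e k * (1 - p) = 0) ∧ (τ p).re ≤ s := by
  have hc : ∀ k : ℕ, (0 : ℝ) < (1 / 2) ^ k := fun k => by positivity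
  have hsm : Summable fun k : ℕ => ((1 / 2 : ℝ) ^ k) • e k := by
    refine Summable.of_norm_bounded (summable_geometric_two) fun k => ?_
    rw [norm_smul, Real.norm_of_nonneg (hc k).le]
    exact mul_le_of_le_one_right (hc k).le (he k).norm_le_one
  set b : M.Elem := ∑' k : ℕ, ((1 / 2 : ℝ) ^ k) • e k
  have hnn : ∀ k : ℕ, 0 ≤ ((1 / 2 : ℝ) ^ k) • e k := fun k => smul_nonneg (hc k).le (he k).nonneg
  have hle : ∀ k : ℕ, ((1 / 2 : ℝ) ^ k) • e k ≤ b := fun k =>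
    hsm.le_tsum k fun j _ => hnn j
  have hb : 0 ≤ b := (hnn 0).trans (hle 0)
  have hbsa : IsSelfAdjoint b := IsSelfAdjoint.of_nonneg hb
  obtain ⟨q, hq, hbq, -, hcl⟩ := M.exists_kernel_projection b hbsa
  have heq : ∀ k, e k * q = 0 := by
    intro k
    have h1 := star_left_conjugate_le_conjugate (hle k) q
    rw [mul_assoc (star q) b, hbq, mul_zero, mul_smul_comm, smul_mul_assoc] at h1
    have h2 : 0 ≤ star q * e k * q := star_left_conjugate_nonneg (he k).nonneg q
    have h3 : star q * e k * q = 0 := by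
      have h4 := le_antisymm h1 (smul_nonneg (hc k).le h2)
      exact (smul_eq_zero.1 h4).resolve_left (hc k).ne'
    rw [← CStarRing.star_mul_self_eq_zero_iff, star_mul, (he k).isSelfAdjoint.star_eq, mul_assoc,
      ← mul_assoc (e k), (he k).isIdempotentElem.eq, ← mul_assoc]
    exact h3
  choose y hy hyb hby hy1 using fun n : ℕ =>
    exists_resolvent hb (δ := 1 / ((n : ℝ) + 1)) (by positivity)
  have hyn : ∀ n : ℕ, ‖(1 / ((n : ℝ) + 1)) • y n‖ ≤ 1 := fun n =>
    (CStarAlgebra.norm_le_one_iff_of_nonneg _ (smul_nonneg (by positivity) (hy n))).2 (hy1 n)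
  have hbyn : ∀ n, ‖b * y n‖ ≤ 1 := fun n => by
    have h1 : b * y n = 1 - (1 / ((n : ℝ) + 1)) • y n := eq_sub_of_add_eq (hby n)
    rw [h1]
    exact (CStarAlgebra.norm_le_one_iff_of_nonneg _ (sub_nonneg.2 (hy1 n))).2
      (sub_le_self _ (smul_nonneg (by positivity) (hy n)))
  have htr : ∀ n, (τ (b * y n)).re ≤ s := by
    intro n
    have h1 : HasSum (fun k : ℕ => (τ ((((1 / 2 : ℝ) ^ k) • e k) * y n)).re) (τ (b * y n)).re := by
      have h3 : HasSum (fun k : ℕ => τ ((((1 / 2 : ℝ) ^ k) • e k) * y n)) (τ (b * y n)) :=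
        (hsm.hasSum.mul_right (y n)).mapL ⟨τ.toLinearMap, map_continuous τ⟩
      exact Complex.hasSum_re h3
    refine hasSum_le (fun k => ?_) h1 ht
    refine le_trans ?_ (het k)
    have h4 := smul_conjugate_resolvent_le (he k) (hc k) (by positivity) (hle k) (hy n) (hby n)
    have h5 : τ ((((1 / 2 : ℝ) ^ k) • e k) * y n) = τ (((1 / 2 : ℝ) ^ k) • (e k * y n * e k)) := by
      rw [← (he k).isIdempotentElem.eq, smul_mul_assoc, ← mul_smul_comm, mul_assoc, mul_assoc,
        hτ.map_mul_comm]
      simp only [smul_mul_assoc, mul_smul_comm, mul_assoc, (he k).isIdempotentElem.eq]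
    rw [h5]
    exact re_apply_mono τ h4
  have hlim : ∀ ξ, Tendsto (fun n => M.incl (b * y n) ξ) atTop (𝓝 (M.incl (1 - q) ξ)) := by
    intro ξ
    have hbyq : ∀ n, b * y n * (1 - q) = b * y n := fun n => by
      rw [mul_sub, mul_one, ← hyb, mul_assoc, hbq, mul_zero, sub_zero]
    have hdiff : ∀ n, M.incl (b * y n) ξ =
        M.incl (1 - q) ξ - M.incl ((1 / ((n : ℝ) + 1)) • y n) (M.incl (1 - q) ξ) := fun n => by
      have h1 : b * y n = (1 - q) - (1 / ((n : ℝ) + 1)) • y n * (1 - q) := by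
        rw [← hbyq n, eq_sub_of_add_eq (hby n), sub_mul, one_mul]
      rw [h1, map_sub, map_mul]
      rfl
    have hz : ∀ ζ ∈ closure (Set.range (M.incl b)),
        Tendsto (fun n : ℕ => M.incl ((1 / ((n : ℝ) + 1)) • y n) ζ) atTop (𝓝 0) := by
      intro ζ hζ
      rw [Metric.tendsto_atTop]
      intro ε hε
      obtain ⟨_, ⟨θ, rfl⟩, hθ⟩ := Metric.mem_closure_iff.1 hζ (ε / 2) (by positivity)
      obtain ⟨N, hN⟩ := exists_nat_gt (‖θ‖ / (ε / 2))
      refine ⟨N, fun n hn => ?_⟩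
      have hn' : ‖θ‖ < (ε / 2) * ((n : ℝ) + 1) := by
        rw [div_lt_iff₀ (by positivity)] at hN
        have : (N : ℝ) ≤ n := by exact_mod_cast hn
        nlinarith
      set Y := M.incl ((1 / ((n : ℝ) + 1)) • y n)
      have hY : ‖Y‖ ≤ 1 := hyn n
      have h1 : Y (M.incl b θ) = (((1 / ((n : ℝ) + 1) : ℝ)) : ℂ) • M.incl (b * y n) θ := by
        have h2 : Y * M.incl b = (((1 / ((n : ℝ) + 1) : ℝ)) : ℂ) • M.incl (b * y n) := by
          rw [← map_mul, ← map_smul, Complex.coe_smul, smul_mul_assoc, hyb]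
        exact congr($h2 θ)
      rw [dist_zero_right]
      calc ‖Y ζ‖ = ‖Y (ζ - M.incl b θ) + Y (M.incl b θ)‖ := by rw [← map_add, sub_add_cancel]
        _ ≤ ‖Y (ζ - M.incl b θ)‖ + ‖Y (M.incl b θ)‖ := norm_add_le _ _
        _ ≤ 1 * ‖ζ - M.incl b θ‖ + (1 / ((n : ℝ) + 1)) * (1 * ‖θ‖) := by
            gcongr
            · exact Y.le_of_opNorm_le hY _
            · rw [h1, norm_smul, Complex.norm_real, Real.norm_of_nonneg (by positivity)]
              gcongr
              exact (M.incl (b * y n)).le_of_opNorm_le (hbyn n) _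
        _ < ε / 2 + ε / 2 := by
            refine add_lt_add ?_ ?_
            · rwa [one_mul, ← dist_eq_norm]
            · rw [one_mul, one_div, inv_mul_lt_iff₀ (by positivity), mul_comm]
              exact hn'
        _ = ε := add_halves ε
    have h0 : M.incl (1 - q) ξ ∈ closure (Set.range (M.incl b)) := by
      have h1 : M.incl (1 - q) ξ = ξ - M.incl q ξ := by
        rw [map_sub M.incl, _root_.map_one M.incl]
        rfl
      rw [h1]
      exact hcl ξ
    have := (tendsto_const_nhds (x := M.incl (1 - q) ξ)).sub (hz _ h0)
    rw [sub_zero] at this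
    exact this.congr fun n => (hdiff n).symm
  refine ⟨1 - q, hq.one_sub, fun k => by rw [sub_sub_cancel]; exact heq k, ?_⟩
  have := hτ.normal.tendsto hbyn hlim
  exact le_of_tendsto ((Complex.continuous_re.tendsto _).comp this) (Eventually.of_forall htr)

end VonNeumannAlgebra

namespace NCInt

section Bimodule

variable {A : Type*} [CStarAlgebra A]

theorem bimul_apply (a b x : A) (f : StrongDual ℂ A) : bimul a f b x = f (b * x * a) := rfl

theorem bimul_bimul (a b c d : A) (f : StrongDual ℂ A) :
    bimul a (bimul c f d) b = bimul (a * c) f (d * b) := by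
  ext x
  simp only [bimul_apply, mul_assoc]

theorem corner_add (e : A) (f g : StrongDual ℂ A) : corner e (f + g) = corner e f + corner e g :=
  rfl

theorem corner_corner {e p : A} (he : IsStarProjection e) (hp : IsStarProjection p)
    (hep : e * (1 - p) = 0) (f : StrongDual ℂ A) : corner p (corner e f) = corner p f := by
  have hpe : (1 - p) * e = 0 := by
    have := congr(star $hep)
    rwa [star_mul, he.isSelfAdjoint.star_eq, hp.one_sub.isSelfAdjoint.star_eq, star_zero] at this
  rw [corner, corner, bimul_bimul, mul_sub, mul_one, hpe, sub_mul, one_mul, hep, sub_zero, corner]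

theorem tendsto_dual_apply {f : ℕ → StrongDual ℂ A} {g : StrongDual ℂ A}
    (h : Tendsto f atTop (𝓝 g)) (x : A) : Tendsto (fun n => f n x) atTop (𝓝 (g x)) :=
  ((ContinuousLinearMap.apply ℂ ℂ x).continuous.tendsto g).comp h

end Bimodule

variable {A : Type*} [CStarAlgebra A] [PartialOrder A] [StarOrderedRing A]

/-! ### The trace norm -/

theorem norm_toL2_sq (τ : A →ₚ[ℂ] ℂ) (a : A) : ‖toL2 τ a‖ ^ 2 = (τ (star a * a)).re := by
  have h : ‖toL2 τ a‖ = ‖τ.toPreGNS a‖ := UniformSpace.Completion.norm_coe _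
  have h2 := τ.preGNS_norm_sq (τ.toPreGNS a)
  rw [h]
  simpa [← Complex.ofReal_pow] using congr(Complex.re $h2)

theorem inner_toL2 (τ : A →ₚ[ℂ] ℂ) (a b : A) : ⟪toL2 τ a, toL2 τ b⟫_ℂ = τ (star a * b) := by
  rw [toL2, toL2, UniformSpace.Completion.inner_coe, τ.preGNS_inner_def]
  simp

theorem toL2_add (τ : A →ₚ[ℂ] ℂ) (a b : A) : toL2 τ (a + b) = toL2 τ a + toL2 τ b := by
  simp [toL2, UniformSpace.Completion.coe_add]

theorem norm_toL2_mul_le (τ : A →ₚ[ℂ] ℂ) (a b : A) : ‖toL2 τ (a * b)‖ ≤ ‖a‖ * ‖toL2 τ b‖ := by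
  have h1 := (τ.gnsStarAlgHom a).le_opNorm (toL2 τ b)
  have h2 := NonUnitalStarAlgHom.norm_apply_le τ.gnsStarAlgHom a
  rw [← leftMul_toL2]
  exact h1.trans (by gcongr)

theorem norm_apply_conjugate_le (τ : A →ₚ[ℂ] ℂ) (c z : A) :
    ‖τ (star c * z * c)‖ ≤ ‖z‖ * (τ (star c * c)).re := by
  rw [mul_assoc, ← inner_toL2, ← norm_toL2_sq]
  calc ‖⟪toL2 τ c, toL2 τ (z * c)⟫_ℂ‖ ≤ ‖toL2 τ c‖ * ‖toL2 τ (z * c)‖ := norm_inner_le_norm _ _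
    _ ≤ ‖toL2 τ c‖ * (‖z‖ * ‖toL2 τ c‖) := by gcongr; exact norm_toL2_mul_le τ z c
    _ = ‖z‖ * ‖toL2 τ c‖ ^ 2 := by ring

theorem norm_apply_le_of_map_one {τ : A →ₚ[ℂ] ℂ} (h1 : τ 1 = 1) (x : A) : ‖τ x‖ ≤ ‖x‖ := by
  simpa [h1] using norm_apply_conjugate_le τ 1 x

theorem norm_embed_le {τ : A →ₚ[ℂ] ℂ} (h1 : τ 1 = 1) (y : A) : ‖embed τ y‖ ≤ ‖y‖ :=
  ContinuousLinearMap.opNorm_le_bound _ (norm_nonneg _) fun x =>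
    (norm_apply_le_of_map_one h1 (y * x)).trans (norm_mul_le _ _)

theorem norm_abs_mul (y z : A) : ‖CFC.abs y * z‖ = ‖y * z‖ := by
  have hsa : IsSelfAdjoint (CFC.abs y) := IsSelfAdjoint.of_nonneg (CFC.abs_nonneg y)
  have h : star (CFC.abs y * z) * (CFC.abs y * z) = star (y * z) * (y * z) := by
    simp only [star_mul, hsa.star_eq, mul_assoc]
    rw [← mul_assoc (CFC.abs y), CFC.abs_mul_abs, mul_assoc]
  have h2 := congr(‖$h‖)
  rw [CStarRing.norm_star_mul_self, CStarRing.norm_star_mul_self] at h2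
  exact (mul_self_inj (norm_nonneg _) (norm_nonneg _)).1 h2

theorem norm_mul_resolvent_le_one {b r : A} {δ : ℝ} (hr : 0 ≤ r) (hδ : 0 ≤ δ)
    (h1 : b * r + δ • r = 1) (h2 : δ • r ≤ 1) : ‖b * r‖ ≤ 1 ∧ b * r ≤ 1 := by
  have h3 : b * r = 1 - δ • r := eq_sub_of_add_eq h1
  have h4 : 1 - δ • r ≤ 1 := sub_le_self _ (smul_nonneg hδ hr)
  rw [h3]
  exact ⟨(CStarAlgebra.norm_le_one_iff_of_nonneg _ (sub_nonneg.2 h2)).2 h4, h4⟩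

theorem re_apply_abs_le_norm_embed {τ : A →ₚ[ℂ] ℂ} (h1 : τ 1 = 1)
    (hτ : ∀ x y, τ (x * y) = τ (y * x)) (y : A) : (τ (CFC.abs y)).re ≤ ‖embed τ y‖ := by
  refine le_of_forall_pos_le_add fun δ hδ => ?_
  obtain ⟨r, hr, hrb, hbr, hr1⟩ := exists_resolvent (CFC.abs_nonneg y) hδ
  obtain ⟨hn, hle⟩ := norm_mul_resolvent_le_one hr hδ.le hbr hr1
  have hx : ‖r * star y‖ ≤ 1 := by
    have : r * star y = star (y * r) := by rw [star_mul, (IsSelfAdjoint.of_nonneg hr).star_eq]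
    rwa [this, norm_star, ← norm_abs_mul]
  have hsplit : CFC.abs y = CFC.abs y * (CFC.abs y * r) + δ • (CFC.abs y * r) := by
    rw [← mul_smul_comm, ← mul_add, hbr, mul_one]
  have htr : τ (CFC.abs y * (CFC.abs y * r)) = embed τ y (r * star y) := by
    rw [embed_apply, ← mul_assoc, CFC.abs_mul_abs, mul_assoc, hτ, mul_assoc]
  rw [hsplit, map_add, Complex.add_re, re_apply_smul, htr]
  gcongr
  · calc (embed τ y (r * star y)).re ≤ ‖embed τ y (r * star y)‖ := Complex.re_le_norm _
      _ ≤ ‖embed τ y‖ * 1 := (embed τ y).le_of_opNorm_le_of_le le_rfl hx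
      _ = _ := mul_one _
  · have := re_apply_mono τ hle
    rw [h1, Complex.one_re] at this
    exact mul_le_of_le_one_right hδ.le this

theorem norm_embed_le_re_apply_abs {τ : A →ₚ[ℂ] ℂ} (h1 : τ 1 = 1)
    (hτ : ∀ x y, τ (x * y) = τ (y * x)) (y : A) : ‖embed τ y‖ ≤ (τ (CFC.abs y)).re := by
  refine ContinuousLinearMap.opNorm_le_bound _ (re_apply_nonneg τ (CFC.abs_nonneg y)) fun x => ?_
  rw [embed_apply]
  have key : ∀ δ : ℝ, 0 < δ → ‖τ (y * x)‖ ≤ (τ (CFC.abs y)).re * ‖x‖ + δ * ‖x‖ := by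
    intro δ hδ
    obtain ⟨r, hr, hrb, hbr, hr1⟩ := exists_resolvent (CFC.abs_nonneg y) hδ
    obtain ⟨hn, -⟩ := norm_mul_resolvent_le_one hr hδ.le hbr hr1
    rw [norm_abs_mul] at hn
    set b := CFC.abs y
    set c := CFC.sqrt b
    have hcc : c * c = b := CFC.sqrt_mul_sqrt_self b (CFC.abs_nonneg y)
    have hc : star c = c := (IsSelfAdjoint.of_nonneg (CFC.sqrt_nonneg b)).star_eq
    have hsplit : y * x = y * r * b * x + δ • (y * r * x) := by
      rw [mul_assoc y r b, hrb, ← smul_mul_assoc, ← add_mul, ← mul_smul_comm, ← mul_add, hbr,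
        mul_one]
    have hxw : ‖x * (y * r)‖ ≤ ‖x‖ :=
      (norm_mul_le _ _).trans (mul_le_of_le_one_right (norm_nonneg _) hn)
    have hwx : ‖y * r * x‖ ≤ ‖x‖ :=
      (norm_mul_le _ _).trans (mul_le_of_le_one_left (norm_nonneg _) hn)
    have htr : τ (y * r * b * x) = τ (star c * (x * (y * r)) * c) := by
      have h2 : y * r * (c * c) * x = y * r * c * (c * x) := by simp only [mul_assoc]
      rw [← hcc, hc, h2, hτ]
      simp only [mul_assoc]
    rw [hsplit, map_add, htr]
    refine (norm_add_le _ _).trans (add_le_add ?_ ?_)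
    · refine (norm_apply_conjugate_le τ c _).trans ?_
      rw [hc, hcc, mul_comm]
      have := re_apply_nonneg τ (CFC.abs_nonneg y)
      gcongr
    · rw [← Complex.coe_smul, map_smul, norm_smul, Complex.norm_real, Real.norm_of_nonneg hδ.le]
      gcongr
      exact (norm_apply_le_of_map_one h1 _).trans hwx
  refine le_of_forall_pos_le_add fun ε hε => ?_
  refine (key (ε / (‖x‖ + 1)) (by positivity)).trans ?_
  gcongr
  rw [div_mul_eq_mul_div, div_le_iff₀ (by positivity)]
  gcongr
  linarith

theorem embed_injective {τ : A →ₚ[ℂ] ℂ} (hfaith : ∀ x, 0 ≤ x → τ x = 0 → x = 0) :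
    Function.Injective (embed τ) := by
  refine (injective_iff_map_eq_zero _).2 fun y hy => ?_
  have h : τ (y * star y) = 0 := by rw [← embed_apply, hy]; rfl
  exact CStarRing.mul_star_self_eq_zero_iff y |>.1 (hfaith _ (mul_star_self_nonneg y) h)

/-! ### The `L_∞` norm -/

theorem normInf_embed_le (τ : A →ₚ[ℂ] ℂ) (y : A) : normInf τ (embed τ y) ≤ ‖y‖ₑ :=
  iInf₂_le_of_le y rfl le_rfl

theorem enorm_le_normInf {τ : A →ₚ[ℂ] ℂ} (h1 : τ 1 = 1) (f : StrongDual ℂ A) :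
    ‖f‖ₑ ≤ normInf τ f := by
  refine le_iInf₂ fun y hy => ?_
  rw [← hy]
  exact enorm_le_iff_norm_le.2 (norm_embed_le h1 y)

theorem normInf_add_le (τ : A →ₚ[ℂ] ℂ) (f g : StrongDual ℂ A) :
    normInf τ (f + g) ≤ normInf τ f + normInf τ g := by
  refine ENNReal.le_iInf₂_add_iInf₂ ?_
  rintro y rfl z rfl
  rw [← map_add]
  exact (normInf_embed_le τ _).trans (enorm_add_le _ _)

theorem normInf_bimul_le {τ : A →ₚ[ℂ] ℂ} (hτ : ∀ x y, τ (x * y) = τ (y * x)) {a b : A}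
    (ha : ‖a‖ ≤ 1) (hb : ‖b‖ ≤ 1) (f : StrongDual ℂ A) :
    normInf τ (bimul a f b) ≤ normInf τ f := by
  refine le_iInf₂ fun y hy => ?_
  rw [← hy, bimul_embed τ hτ]
  refine (normInf_embed_le τ _).trans (enorm_le_iff_norm_le.2 ?_)
  calc ‖a * y * b‖ ≤ ‖a‖ * ‖y‖ * ‖b‖ := norm_mul₃_le
    _ ≤ 1 * ‖y‖ * 1 := by gcongr
    _ = ‖y‖ := by ring

theorem normInf_corner_le {τ : A →ₚ[ℂ] ℂ} (hτ : ∀ x y, τ (x * y) = τ (y * x)) {e : A}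
    (he : IsStarProjection e) (f : StrongDual ℂ A) : normInf τ (corner e f) ≤ normInf τ f :=
  normInf_bimul_le hτ he.one_sub.norm_le_one he.one_sub.norm_le_one f

theorem normInf_corner_le_of_le {τ : A →ₚ[ℂ] ℂ} (hτ : ∀ x y, τ (x * y) = τ (y * x)) {e p : A}
    (he : IsStarProjection e) (hp : IsStarProjection p) (hep : e * (1 - p) = 0)
    (f : StrongDual ℂ A) : normInf τ (corner p f) ≤ normInf τ (corner e f) := by
  rw [← corner_corner he hp hep]
  exact normInf_corner_le hτ hp _

/-! ### Products of elements of `L₂` -/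

theorem bimul_triple {τ : A →ₚ[ℂ] ℂ} (hτ : ∀ x y, τ (x * y) = τ (y * x)) {a b : ℕ → A}
    {α β : τ.GNS} {p q u v : A} (ha : Tendsto (fun n => toL2 τ (a n)) atTop (𝓝 α))
    (hb : Tendsto (fun n => toL2 τ (b n)) atTop (𝓝 β))
    (hu : Tendsto (fun n => p * a n) atTop (𝓝 u)) (hv : Tendsto (fun n => b n * q) atTop (𝓝 v))
    (h : A) : bimul p (triple τ α h β) q = embed τ (u * h * v) := by
  ext x
  have h1 : Tendsto (fun n => triple τ (toL2 τ (a n)) h (toL2 τ (b n)) (q * x * p)) atTop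
      (𝓝 (triple τ α h β (q * x * p))) := by
    refine Tendsto.inner (𝕜 := ℂ) (E := τ.GNS) ?_ ?_
    · exact ((starL2 τ).continuous.tendsto _).comp
        (((τ.gnsStarAlgHom (q * x * p)).continuous.tendsto _).comp ha)
    · exact ((τ.gnsStarAlgHom h).continuous.tendsto _).comp hb
  have h2 : Tendsto (fun n => τ (p * a n * h * (b n * q) * x)) atTop (𝓝 (τ (u * h * v * x))) :=
    ((map_continuous τ).tendsto _).comp (((hu.mul_const h).mul hv).mul_const x)
  refine tendsto_nhds_unique h1 (h2.congr fun n => ?_)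
  rw [triple_toL2 τ hτ, embed_apply, hτ (a n * h * b n), hτ (p * a n * h * (b n * q))]
  have : x * (p * a n * h * (b n * q)) = (x * p * a n * h * b n) * q := by simp only [mul_assoc]
  rw [this, hτ]
  simp only [mul_assoc]

theorem triple_zero_left (τ : A →ₚ[ℂ] ℂ) (h : A) (β : τ.GNS) : triple τ 0 h β = 0 := by
  ext x
  change ⟪starL2 τ (τ.gnsStarAlgHom x 0), leftMul τ β h⟫_ℂ = 0
  rw [map_zero, map_zero, inner_zero_left]

theorem triple_zero_right (τ : A →ₚ[ℂ] ℂ) (h : A) (α : τ.GNS) : triple τ α h 0 = 0 := by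
  ext x
  change ⟪starL2 τ (leftMul τ α x), τ.gnsStarAlgHom h 0⟫_ℂ = 0
  rw [map_zero, inner_zero_right]

theorem exists_of_normL1linf_lt {τ : A →ₚ[ℂ] ℂ} {f : ℕ → StrongDual ℂ A} {δ : ℝ≥0}
    (hf : normL1linf τ f < δ) : ∃ (α β : τ.GNS) (h : ℕ → A) (s t K : ℝ), ‖α‖ < s ∧ ‖β‖ < t ∧
      (∀ n, ‖h n‖ ≤ K) ∧ s * K * t < δ ∧ ∀ n, f n = triple τ α (h n) β := by
  simp only [normL1linf, iInf_lt_iff] at hf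
  obtain ⟨α, β, h, hfac, hlt⟩ := hf
  have hδ : 0 < (δ : ℝ) := by
    have : 0 < δ := by exact_mod_cast (zero_le).trans_lt hlt
    exact_mod_cast this
  by_cases hz : α = 0 ∨ β = 0
  · refine ⟨0, 0, 0, 1, 1, 0, by simp, by simp, by simp, by simpa using hδ, fun n => ?_⟩
    rw [hfac n]
    rcases hz with rfl | rfl
    · rw [triple_zero_left, triple_zero_left]
    · rw [triple_zero_right, triple_zero_right]
  push Not at hz
  have hα : ‖α‖ₑ ≠ 0 := by simpa using hz.1
  have hβ : ‖β‖ₑ ≠ 0 := by simpa using hz.2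
  have hK : (⨆ n, ‖h n‖ₑ) ≠ ∞ := by
    intro hK
    rw [hK, ENNReal.mul_top hα, ENNReal.top_mul hβ] at hlt
    exact not_top_lt hlt
  set K := (⨆ n, ‖h n‖ₑ).toReal
  have hlt' : ‖α‖ * K * ‖β‖ < δ := by
    have := (ENNReal.toReal_lt_toReal hlt.ne_top ENNReal.coe_ne_top).2 hlt
    simpa using this
  have hcont : ContinuousAt (fun s : ℝ => (‖α‖ + s) * K * (‖β‖ + s)) 0 := by fun_prop
  have hev : ∀ᶠ s : ℝ in 𝓝 0, (‖α‖ + s) * K * (‖β‖ + s) < δ :=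
    hcont.eventually_lt_const (by simpa using hlt')
  obtain ⟨s, hs, hs0⟩ := ((hev.filter_mono nhdsWithin_le_nhds).and
    (self_mem_nhdsWithin (s := Set.Ioi (0 : ℝ)))).exists
  have hs0 : 0 < s := hs0
  refine ⟨α, β, h, ‖α‖ + s, ‖β‖ + s, K, by linarith, by linarith, fun n => ?_, hs, hfac⟩
  have := (ENNReal.toReal_le_toReal (by simp) hK).2 (le_iSup (fun n => ‖h n‖ₑ) n)
  simpa using this

theorem L1.toDual_mem_closure {τ : A →ₚ[ℂ] ℂ} (f : L1 τ) :
    L1.toDual τ f ∈ closure (Set.range (embed τ)) := by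
  have h1 : L1.toDual τ f ∈ L1Submodule τ := Subtype.property f
  rw [← SetLike.mem_coe, L1Submodule, Submodule.topologicalClosure_coe] at h1
  exact h1

theorem bimul_eq_embed_of_tendsto {τ : A →ₚ[ℂ] ℂ} {y : ℕ → A} {f : StrongDual ℂ A} {q u : A}
    (hy : Tendsto (fun n => embed τ (y n)) atTop (𝓝 f))
    (hu : Tendsto (fun n => y n * q) atTop (𝓝 u)) : bimul 1 f q = embed τ u := by
  ext x
  rw [bimul_apply]
  have h2 : Tendsto (fun n => embed τ (y n * q)) atTop (𝓝 (embed τ u)) :=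
    ((embed τ).continuous.tendsto u).comp hu
  refine tendsto_nhds_unique (tendsto_dual_apply hy (q * x * 1))
    ((tendsto_dual_apply h2 x).congr fun n => ?_)
  rw [embed_apply, embed_apply, mul_one, mul_assoc]

end NCInt

namespace VonNeumannAlgebra.IsFaithfulNormalTracialState

open NCInt

variable {H : Type*} [NormedAddCommGroup H] [InnerProductSpace ℂ H] [CompleteSpace H]
  {M : VonNeumannAlgebra H} {τ : M.Elem →ₚ[ℂ] ℂ}

theorem exists_projection_sup₂ (hτ : M.IsFaithfulNormalTracialState τ) {e₁ e₂ : M.Elem}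
    (h₁ : IsStarProjection e₁) (h₂ : IsStarProjection e₂) :
    ∃ p : M.Elem, IsStarProjection p ∧ e₁ * (1 - p) = 0 ∧ e₂ * (1 - p) = 0 ∧
      (τ p).re ≤ (τ e₁).re + (τ e₂).re := by
  let e : ℕ → M.Elem := fun n => if n = 0 then e₁ else if n = 1 then e₂ else 0
  have he : ∀ k, IsStarProjection (e k) := by
    intro k
    simp only [e]
    split_ifs
    exacts [h₁, h₂, .zero _]
  have hs : HasSum (fun k => (τ (e k)).re) (∑ k ∈ Finset.range 2, (τ (e k)).re) := by
    refine hasSum_sum_of_ne_finset_zero fun k hk => ?_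
    have h0 : k ≠ 0 ∧ k ≠ 1 := by
      rw [Finset.mem_range] at hk
      omega
    simp [e, h0]
  obtain ⟨p, hp, hep, hle⟩ := hτ.exists_projection_sup he hs fun k => le_rfl
  exact ⟨p, hp, hep 0, hep 1, by simpa [Finset.sum_range_succ, e] using hle⟩

/-- The weak type inequality passes from the algebra to its completion: if `φ` satisfies a weak
type inequality, then the elements of the closure of its range are bounded on the complements of
small projections. -/
theorem exists_projection_of_mem_closure (hτ : M.IsFaithfulNormalTracialState τ) {X : Type*}
    [NormedAddCommGroup X] (φ : M.Elem →+ X) {k : ℕ} (hk : k ≠ 0)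
    (hφ : ∀ (y : M.Elem) (r : ℝ), 0 < r → ∃ e : M.Elem, IsStarProjection e ∧
      (τ e).re ≤ (‖φ y‖ / r) ^ k ∧ ‖y * (1 - e)‖ ≤ r)
    {f : X} (hf : f ∈ closure (Set.range φ)) {η r : ℝ} (hη : ‖f‖ < η) (hr : 0 < r) :
    ∃ (e : M.Elem) (y : ℕ → M.Elem) (u : M.Elem), IsStarProjection e ∧
      (τ e).re ≤ 2 * (4 * η / r) ^ k ∧ Tendsto (fun n => φ (y n)) atTop (𝓝 f) ∧
      Tendsto (fun n => y n * (1 - e)) atTop (𝓝 u) ∧ ‖u‖ ≤ r := by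
  have hη0 : 0 < η := (norm_nonneg f).trans_lt hη
  obtain ⟨v, hv, hvr, hv0, hvn⟩ := controlled_sum_of_mem_closure (s := φ.range) (a := f)
    (by simpa using hf) (b := fun n => η * (1 / 4) ^ n) (fun n => by positivity)
  choose w hw using hvr
  have hnorm : ∀ n, ‖φ (w n)‖ ≤ 2 * η * (1 / 4) ^ n := by
    intro n
    rw [hw n]
    rcases Nat.eq_zero_or_pos n with rfl | hn
    · have h1 : ‖v 0‖ ≤ ‖f‖ + ‖-v 0 + f‖ := by
        have h2 : v 0 = f - (-v 0 + f) := by abel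
        nth_rewrite 1 [h2]
        exact norm_sub_le _ _
      simp only [pow_zero, mul_one] at hv0 ⊢
      linarith
    · refine (hvn n hn).le.trans ?_
      gcongr
      linarith
  choose e he het hle using fun n => hφ (w n) (r / 2 * (1 / 2) ^ n) (by positivity)
  have ht : ∀ n, (τ (e n)).re ≤ (4 * η / r) ^ k * (1 / 2) ^ n := by
    intro n
    refine (het n).trans ?_
    have h1 : ‖φ (w n)‖ / (r / 2 * (1 / 2) ^ n) ≤ (4 * η / r) * (1 / 2) ^ n := by
      rw [div_le_iff₀ (by positivity)]
      refine (hnorm n).trans (le_of_eq ?_)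
      have h2 : (1 / 4 : ℝ) ^ n = (1 / 2) ^ n * (1 / 2) ^ n := by rw [← mul_pow]; norm_num
      rw [h2]
      field_simp
      ring
    calc (‖φ (w n)‖ / (r / 2 * (1 / 2) ^ n)) ^ k ≤ ((4 * η / r) * (1 / 2) ^ n) ^ k := by gcongr
      _ = (4 * η / r) ^ k * ((1 / 2) ^ n) ^ k := mul_pow _ _ _
      _ ≤ (4 * η / r) ^ k * (1 / 2) ^ n := by
          gcongr
          exact pow_le_of_le_one (by positivity) (pow_le_one₀ (by norm_num) (by norm_num)) hk
  obtain ⟨p, hp, hep, hps⟩ := hτ.exists_projection_sup he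
    (hasSum_geometric_two.mul_left ((4 * η / r) ^ k)) ht
  have hwp : ∀ n, ‖w n * (1 - p)‖ ≤ r / 2 * (1 / 2) ^ n := by
    intro n
    have h1 : w n * (1 - p) = w n * (1 - e n) * (1 - p) := by
      rw [mul_assoc, sub_mul 1 (e n), hep n, one_mul, sub_zero]
    rw [h1]
    refine (norm_mul_le _ _).trans ((mul_le_of_le_one_right (norm_nonneg _) ?_).trans (hle n))
    exact hp.one_sub.norm_le_one
  have hsum : HasSum (fun n : ℕ => r / 2 * (1 / 2 : ℝ) ^ n) r := by
    simpa using hasSum_geometric_two.mul_left (r / 2)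
  have hsm : Summable fun n => w n * (1 - p) := Summable.of_norm_bounded hsum.summable hwp
  refine ⟨p, fun n => ∑ i ∈ Finset.range (n + 1), w i, ∑' n, w n * (1 - p), hp, ?_, ?_, ?_, ?_⟩
  · rwa [mul_comm]
  · simpa only [map_sum, hw] using hv
  · simp_rw [Finset.sum_mul]
    exact hsm.hasSum.tendsto_sum_nat.comp (tendsto_add_atTop_nat 1)
  · exact tsum_of_norm_bounded hsum hwp

theorem exists_projection_embed (hτ : M.IsFaithfulNormalTracialState τ) (y : M.Elem) {r : ℝ}
    (hr : 0 < r) : ∃ e : M.Elem, IsStarProjection e ∧ (τ e).re ≤ (‖embed τ y‖ / r) ^ 1 ∧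
      ‖y * (1 - e)‖ ≤ r := by
  obtain ⟨e, he, h1, h2⟩ := M.exists_projection_norm_mul_le τ (CFC.abs_nonneg y) hr.le
  refine ⟨e, he, ?_, ?_⟩
  · rw [pow_one, le_div_iff₀ hr, mul_comm]
    exact h1.trans (re_apply_abs_le_norm_embed hτ.map_one hτ.map_mul_comm y)
  · rwa [← norm_abs_mul]

theorem exists_projection_toL2 (y : M.Elem) {r : ℝ} (hr : 0 < r) :
    ∃ e : M.Elem, IsStarProjection e ∧ (τ e).re ≤ (‖toL2 τ y‖ / r) ^ 2 ∧ ‖y * (1 - e)‖ ≤ r := by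
  obtain ⟨e, he, h1, h2⟩ := M.exists_projection_norm_mul_le τ (star_mul_self_nonneg y)
    (sq_nonneg r)
  refine ⟨e, he, ?_, ?_⟩
  · rw [div_pow, le_div_iff₀ (by positivity), norm_toL2_sq, mul_comm]
    exact h1
  · refine (sq_le_sq₀ (norm_nonneg _) hr.le).1 ?_
    calc ‖y * (1 - e)‖ ^ 2 = ‖star (y * (1 - e)) * (y * (1 - e))‖ := by
          rw [CStarRing.norm_star_mul_self, sq]
      _ = ‖(1 - e) * (star y * y * (1 - e))‖ := by
          rw [star_mul, he.one_sub.isSelfAdjoint.star_eq]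
          simp only [mul_assoc]
      _ ≤ ‖1 - e‖ * ‖star y * y * (1 - e)‖ := norm_mul_le _ _
      _ ≤ 1 * r ^ 2 := by
          gcongr
          exact he.one_sub.norm_le_one
      _ = r ^ 2 := one_mul _

theorem exists_projection_bimul_eq_embed (hτ : M.IsFaithfulNormalTracialState τ) (f : L1 τ)
    {η r : ℝ} (hη : ‖f‖ < η) (hr : 0 < r) :
    ∃ e u : M.Elem, IsStarProjection e ∧ (τ e).re ≤ 8 * η / r ∧ ‖u‖ ≤ r ∧
      bimul 1 (L1.toDual τ f) (1 - e) = embed τ u := by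
  let φ : M.Elem →+ StrongDual ℂ M.Elem := AddMonoidHom.mk' (embed τ) (map_add _)
  obtain ⟨e, y, u, he, hle, hy, hu, hur⟩ := hτ.exists_projection_of_mem_closure
    φ one_ne_zero (fun y r hr => hτ.exists_projection_embed y hr)
    (L1.toDual_mem_closure f) (η := η) (by rwa [(L1.toDual τ).norm_map]) hr
  refine ⟨e, u, he, hle.trans (le_of_eq (by ring)), hur, ?_⟩
  exact bimul_eq_embed_of_tendsto hy hu

theorem exists_projection_normInf_corner_le (hτ : M.IsFaithfulNormalTracialState τ) (f : L1 τ)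
    {η r : ℝ} (hη : ‖f‖ < η) (hr : 0 < r) :
    ∃ e : M.Elem, IsStarProjection e ∧ (τ e).re ≤ 8 * η / r ∧
      normInf τ (corner e (L1.toDual τ f)) ≤ ENNReal.ofReal r := by
  obtain ⟨e, u, he, hle, hu, hfu⟩ := hτ.exists_projection_bimul_eq_embed f hη hr
  refine ⟨e, he, hle, ?_⟩
  have h1 : corner e (L1.toDual τ f) = bimul (1 - e) (embed τ u) 1 := by
    rw [← hfu, bimul_bimul, mul_one, corner]
  rw [h1]
  refine (normInf_bimul_le hτ.map_mul_comm he.one_sub.norm_le_one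
    (IsStarProjection.one _).norm_le_one _).trans ((normInf_embed_le τ u).trans ?_)
  rw [← ofReal_norm]
  exact ENNReal.ofReal_le_ofReal hu

theorem exists_projection_normInf_corner_le_of_normL1linf_lt
    (hτ : M.IsFaithfulNormalTracialState τ) {f : ℕ → StrongDual ℂ M.Elem} {δ : ℝ≥0}
    (hf : normL1linf τ f < δ) {c : ℝ} (hc : 0 < c) :
    ∃ p : M.Elem, IsStarProjection p ∧ (τ p).re ≤ 4 * (4 / c) ^ 2 ∧
      ∀ n, normInf τ (corner p (f n)) ≤ ENNReal.ofReal (c ^ 2 * δ) := by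
  obtain ⟨α, β, h, s, t, K, hα, hβ, hK, hlt, hfac⟩ := exists_of_normL1linf_lt hf
  have hs : 0 < s := (norm_nonneg _).trans_lt hα
  have ht : 0 < t := (norm_nonneg _).trans_lt hβ
  have hK0 : 0 ≤ K := (norm_nonneg _).trans (hK 0)
  have hdense : ∀ ξ : τ.GNS, ξ ∈ closure (Set.range (toL2 τ)) := fun ξ =>
    UniformSpace.Completion.denseRange_coe (α := τ.PreGNS) ξ
  let φ : M.Elem →+ τ.GNS := AddMonoidHom.mk' (toL2 τ) (toL2_add τ)
  let ψ : M.Elem →+ τ.GNS := AddMonoidHom.mk' (fun y => toL2 τ (star y)) fun x y => by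
    rw [star_add, toL2_add]
  have hψ : ∀ y, ‖ψ y‖ = ‖toL2 τ y‖ := by
    intro y
    rw [← sq_eq_sq₀ (norm_nonneg _) (norm_nonneg _), norm_toL2_sq]
    refine (norm_toL2_sq τ (star y)).trans ?_
    rw [star_star, hτ.map_mul_comm]
  obtain ⟨e₁, b, v, he₁, hle₁, hb, hv, hvn⟩ := hτ.exists_projection_of_mem_closure φ two_ne_zero
    (fun y r hr => exists_projection_toL2 y hr) (hdense β) hβ (mul_pos hc ht)
  have hdense' : α ∈ closure (Set.range ψ) := by
    have h1 : Set.range ψ = Set.range (toL2 τ) := star_involutive.surjective.range_comp (toL2 τ)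
    rw [h1]
    exact hdense α
  obtain ⟨e₂, a, u, he₂, hle₂, ha, hu, hun⟩ := hτ.exists_projection_of_mem_closure ψ two_ne_zero
    (fun y r hr => by rw [hψ]; exact exists_projection_toL2 y hr) hdense' hα (mul_pos hc hs)
  obtain ⟨p, hp, h1p, h2p, hple⟩ := hτ.exists_projection_sup₂ he₁ he₂
  refine ⟨p, hp, ?_, fun n => ?_⟩
  · have h1 : 4 * t / (c * t) = 4 / c := by field_simp
    have h2 : 4 * s / (c * s) = 4 / c := by field_simp
    rw [h1] at hle₁
    rw [h2] at hle₂
    linarith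
  · have hv' : Tendsto (fun n => b n * (1 - p)) atTop (𝓝 (v * (1 - p))) := by
      refine (hv.mul_const (1 - p)).congr fun n => ?_
      rw [mul_assoc, sub_mul 1 e₁, h1p, one_mul, sub_zero]
    have hu' : Tendsto (fun n => (1 - p) * star (a n)) atTop (𝓝 (star (u * (1 - p)))) := by
      refine ((hu.mul_const (1 - p)).star).congr fun n => ?_
      rw [mul_assoc, sub_mul 1 e₂, h2p, one_mul, sub_zero, star_mul,
        hp.one_sub.isSelfAdjoint.star_eq]
    rw [corner, hfac n, bimul_triple hτ.map_mul_comm ha hb hu' hv' (h n)]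
    refine (normInf_embed_le τ _).trans ?_
    rw [← ofReal_norm]
    refine ENNReal.ofReal_le_ofReal ?_
    have hp1 := hp.one_sub.norm_le_one
    have h3 : ‖star (u * (1 - p))‖ ≤ c * s := by
      rw [norm_star]
      exact (norm_mul_le _ _).trans ((mul_le_of_le_one_right (norm_nonneg _) hp1).trans hun)
    have h4 : ‖v * (1 - p)‖ ≤ c * t :=
      (norm_mul_le _ _).trans ((mul_le_of_le_one_right (norm_nonneg _) hp1).trans hvn)
    calc ‖star (u * (1 - p)) * h n * (v * (1 - p))‖
        ≤ ‖star (u * (1 - p))‖ * ‖h n‖ * ‖v * (1 - p)‖ := norm_mul₃_le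
      _ ≤ (c * s) * K * (c * t) := by
          gcongr
          exact hK n
      _ = c ^ 2 * (s * K * t) := by ring
      _ ≤ c ^ 2 * δ := by gcongr

end VonNeumannAlgebra.IsFaithfulNormalTracialState

namespace NCInt

/-! ### Orlicz functions -/

theorem IsOrliczFunction.exists_linear_bound {Φ : ℝ≥0 → ℝ≥0} (hΦ : IsOrliczFunction Φ) :
    ∃ a : ℝ≥0, 0 < a ∧ ∀ t, t ≤ a * (Φ t + 1) := by
  obtain ⟨a, ha⟩ := (hΦ.tendsto_atTop.eventually_ge_atTop 1).exists
  have ha0 : 0 < a := by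
    rcases eq_or_ne a 0 with rfl | h
    · rw [hΦ.map_zero] at ha
      exact absurd ha (by simp)
    · exact pos_iff_ne_zero.2 h
  refine ⟨a, ha0, fun t => ?_⟩
  rcases le_total t a with h | h
  · calc t ≤ a * 1 := by rwa [mul_one]
      _ ≤ a * (Φ t + 1) := by gcongr; exact le_add_self
  · have ht : 0 < t := ha0.trans_le h
    have h1 : a / t + (1 - a / t) = 1 := add_tsub_cancel_of_le (div_le_one_of_le₀ h (zero_le))
    have h2 := hΦ.convexOn.2 (Set.mem_univ t) (Set.mem_univ 0) (zero_le) (zero_le) h1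
    simp only [smul_eq_mul, mul_zero, add_zero, hΦ.map_zero, div_mul_cancel₀ _ ht.ne'] at h2
    have h3 : 1 ≤ a / t * Φ t := ha.trans h2
    calc t = t * 1 := (mul_one t).symm
      _ ≤ t * (a / t * Φ t) := by gcongr
      _ = a * Φ t := by field_simp
      _ ≤ a * (Φ t + 1) := by gcongr; exact le_self_add

theorem IsOrliczFunction.continuous {Φ : ℝ≥0 → ℝ≥0} (hΦ : IsOrliczFunction Φ) :
    Continuous fun s : ℝ => (Φ s.toNNReal : ℝ) := by
  have hconv : ConvexOn ℝ Set.univ fun s : ℝ => (Φ s.toNNReal : ℝ) := by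
    refine ⟨convex_univ, fun x _ y _ a b ha hb hab => ?_⟩
    lift a to ℝ≥0 using ha
    lift b to ℝ≥0 using hb
    have hab' : a + b = 1 := by exact_mod_cast hab
    have h1 : ((a : ℝ) • x + (b : ℝ) • y).toNNReal ≤ a • x.toNNReal + b • y.toNNReal := by
      rw [Real.toNNReal_le_iff_le_coe]
      simp only [smul_eq_mul, NNReal.coe_add, NNReal.coe_mul]
      gcongr <;> exact Real.le_coe_toNNReal _
    have h2 := (hΦ.monotone h1).trans
      (hΦ.convexOn.2 (Set.mem_univ x.toNNReal) (Set.mem_univ y.toNNReal) (zero_le) (zero_le) hab')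
    exact_mod_cast h2
  exact continuousOn_univ.1 (hconv.continuousOn isOpen_univ)

section Orlicz

variable {A : Type*} [CStarAlgebra A] [PartialOrder A] [StarOrderedRing A]

theorem norm_embed_le_of_modularAlg_le_one {τ : A →ₚ[ℂ] ℂ} (h1 : τ 1 = 1)
    (hτ : ∀ x y, τ (x * y) = τ (y * x)) {Φ : ℝ≥0 → ℝ≥0} (hΦ : IsOrliczFunction Φ) {a : ℝ≥0}
    (ha : ∀ t, t ≤ a * (Φ t + 1)) {y : A} (hy : modularAlg τ Φ y ≤ 1) :
    ‖embed τ y‖ ≤ 2 * a := by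
  have hsa : IsSelfAdjoint (CFC.abs y) := IsSelfAdjoint.of_nonneg (CFC.abs_nonneg y)
  set ψ : ℝ → ℝ := fun s : ℝ => (Φ s.toNNReal : ℝ)
  have hψ : Continuous ψ := hΦ.continuous
  have h2 : CFC.abs y ≤ (a : ℝ) • (cfc ψ (CFC.abs y) + 1) := by
    have h3 : (a : ℝ) • (cfc ψ (CFC.abs y) + 1) = cfc (fun s => (a : ℝ) * (ψ s + 1)) (CFC.abs y) := by
      rw [cfc_const_mul (a : ℝ) (fun s => ψ s + 1) (CFC.abs y) (by fun_prop),
        cfc_add (a := CFC.abs y) ψ (fun _ => 1) hψ.continuousOn (by fun_prop), cfc_const_one ℝ (CFC.abs y)]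
    rw [h3]
    nth_rewrite 1 [← cfc_id' ℝ (CFC.abs y)]
    refine cfc_mono (fun s _ => ?_) (by fun_prop) (by fun_prop)
    refine (Real.le_coe_toNNReal s).trans ?_
    exact_mod_cast ha s.toNNReal
  have h4 : (τ (cfc ψ (CFC.abs y))).re ≤ 1 := by
    rwa [modularAlg, ENNReal.ofReal_le_one] at hy
  calc ‖embed τ y‖ ≤ (τ (CFC.abs y)).re := norm_embed_le_re_apply_abs h1 hτ y
    _ ≤ (τ ((a : ℝ) • (cfc ψ (CFC.abs y) + 1))).re := re_apply_mono τ h2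
    _ = a * ((τ (cfc ψ (CFC.abs y))).re + 1) := by
        rw [re_apply_smul, map_add, h1, Complex.add_re, Complex.one_re]
    _ ≤ a * (1 + 1) := by gcongr
    _ = 2 * a := by ring

theorem toL1_mem_LPhi {τ : A →ₚ[ℂ] ℂ} (h1 : τ 1 = 1) (hτ : ∀ x y, τ (x * y) = τ (y * x))
    (hfaith : ∀ x, 0 ≤ x → τ x = 0 → x = 0) {Φ : ℝ≥0 → ℝ≥0} (hΦ : IsOrliczFunction Φ) (y : A) :
    toL1 τ y ∈ LPhi τ Φ := by
  refine ⟨1, one_pos, ?_⟩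
  rw [NNReal.coe_one, Complex.ofReal_one, inv_one, one_smul]
  refine lt_of_le_of_lt (b := (Φ ‖y‖₊ : ℝ≥0∞)) ?_ ENNReal.coe_lt_top
  refine iSup₂_le fun e he => iSup₂_le fun z hz => ?_
  have hz' : embed τ z = embed τ (1 * y * e) := by
    rw [hz, ← bimul_embed τ hτ]
    rfl
  have hzy : ‖z‖ ≤ ‖y‖ := by
    rw [embed_injective hfaith hz', one_mul]
    exact (norm_mul_le _ _).trans (mul_le_of_le_one_right (norm_nonneg _) he.norm_le_one)
  have hle : cfc (fun s : ℝ => (Φ s.toNNReal : ℝ)) (CFC.abs z) ≤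
      algebraMap ℝ A (Φ ‖y‖₊ : ℝ) := by
    refine cfc_le_algebraMap _ _ _ (fun s hs => ?_) hΦ.continuous.continuousOn
      (IsSelfAdjoint.of_nonneg (CFC.abs_nonneg z))
    have h2 : s ≤ ‖z‖ := by
      rw [← CFC.norm_abs (a := z)]
      have : Nontrivial A := by
        by_contra h
        rw [not_nontrivial_iff_subsingleton] at h
        rw [Subsingleton.elim (1 : A) 0, map_zero] at h1
        exact zero_ne_one h1
      exact (le_abs_self s).trans (spectrum.norm_le_norm_of_mem hs)
    have h3 : s.toNNReal ≤ ‖y‖₊ := by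
      rw [Real.toNNReal_le_iff_le_coe]
      exact h2.trans hzy
    exact_mod_cast hΦ.monotone h3
  rw [modularAlg, ← ENNReal.ofReal_coe_nnreal]
  refine ENNReal.ofReal_le_ofReal ((re_apply_mono τ hle).trans (le_of_eq ?_))
  rw [Algebra.algebraMap_eq_smul_one, re_apply_smul, h1, Complex.one_re, mul_one]

theorem norm_toL2_le {τ : A →ₚ[ℂ] ℂ} (h1 : τ 1 = 1) (a : A) : ‖toL2 τ a‖ ≤ ‖a‖ := by
  have h2 : ‖toL2 τ 1‖ ^ 2 = 1 := by simp [norm_toL2_sq, h1]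
  have h3 : ‖toL2 τ 1‖ = 1 := (pow_eq_one_iff_of_nonneg (norm_nonneg _) two_ne_zero).1 h2
  simpa [h3] using norm_toL2_mul_le τ a 1

theorem norm_apply_mul_le_of_projection {τ : A →ₚ[ℂ] ℂ} (h1 : τ 1 = 1) {e : A}
    (he : IsStarProjection e) {r : ℝ} (hr : 0 ≤ r) (her : (τ e).re ≤ r ^ 2) (x : A) :
    ‖τ (x * e)‖ ≤ ‖x‖ * r := by
  have h2 : ‖toL2 τ e‖ ≤ r := by
    refine (sq_le_sq₀ (norm_nonneg _) hr).1 ?_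
    rwa [norm_toL2_sq, he.isSelfAdjoint.star_eq, he.isIdempotentElem.eq]
  have h3 : τ (x * e) = ⟪toL2 τ (star x), toL2 τ e⟫_ℂ := by rw [inner_toL2, star_star]
  rw [h3]
  refine (norm_inner_le_norm _ _).trans ?_
  gcongr
  simpa using norm_toL2_le h1 (star x)

end Orlicz

end NCInt

namespace VonNeumannAlgebra.IsFaithfulNormalTracialState

open NCInt

variable {H : Type*} [NormedAddCommGroup H] [InnerProductSpace ℂ H] [CompleteSpace H]
  {M : VonNeumannAlgebra H} {τ : M.Elem →ₚ[ℂ] ℂ}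

/-- The norm of `L₁` is determined by the bounded cut-downs. -/
theorem norm_le_of_forall_bimul (hτ : M.IsFaithfulNormalTracialState τ) (f : L1 τ) {C : ℝ}
    (hC : 0 ≤ C) (h : ∀ e : M.Elem, IsStarProjection e → ∀ y : M.Elem,
      embed τ y = bimul 1 (L1.toDual τ f) e → ‖embed τ y‖ ≤ C) : ‖f‖ ≤ C := by
  rw [← (L1.toDual τ).norm_map]
  set g := L1.toDual τ f
  refine le_of_forall_pos_le_add fun ε hε => ?_
  obtain ⟨_, ⟨z, rfl⟩, hz⟩ := Metric.mem_closure_iff.1 (L1.toDual_mem_closure f) (ε / 2)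
    (by positivity)
  rw [dist_eq_norm] at hz
  set ρ : ℝ := ε / 2 / (‖z‖ + 1)
  have hρ : 0 < ρ := by positivity
  obtain ⟨e, u, he, hle, -, hu⟩ := hτ.exists_projection_bimul_eq_embed f (η := ‖f‖ + 1)
    (r := 8 * (‖f‖ + 1) / ρ ^ 2) (by linarith) (by positivity)
  have hle' : (τ e).re ≤ ρ ^ 2 := hle.trans (le_of_eq (by field_simp))
  have hCu := h (1 - e) he.one_sub u hu.symm
  refine ContinuousLinearMap.opNorm_le_bound _ (by positivity) fun x => ?_
  have hsplit : g x = embed τ u x + ((g - embed τ z) (e * x) + τ (x * z * e)) := by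
    have h1 : embed τ u x = g ((1 - e) * x) := by
      rw [← hu, bimul_apply, mul_one]
    have h2 : τ (x * z * e) = embed τ z (e * x) := by
      rw [embed_apply, mul_assoc, hτ.map_mul_comm, mul_assoc]
    have h3 : (g - embed τ z) (e * x) = g (e * x) - embed τ z (e * x) := rfl
    rw [h1, h2, h3, sub_mul, one_mul, map_sub]
    ring
  have hb1 : ‖embed τ u x‖ ≤ C * ‖x‖ := (embed τ u).le_of_opNorm_le hCu x
  have hex : ‖e * x‖ ≤ ‖x‖ :=
    (norm_mul_le _ _).trans (mul_le_of_le_one_left (norm_nonneg _) he.norm_le_one)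
  have hb2 : ‖(g - embed τ z) (e * x)‖ ≤ ε / 2 * ‖x‖ :=
    (g - embed τ z).le_of_opNorm_le_of_le hz.le hex
  have hb3 : ‖τ (x * z * e)‖ ≤ ε / 2 * ‖x‖ := by
    refine (norm_apply_mul_le_of_projection hτ.map_one he hρ.le hle' _).trans ?_
    calc ‖x * z‖ * ρ ≤ ‖x‖ * ‖z‖ * ρ := by gcongr; exact norm_mul_le _ _
      _ ≤ ‖x‖ * (‖z‖ + 1) * ρ := by gcongr; linarith
      _ = ε / 2 * ‖x‖ := by simp only [ρ]; field_simp
  calc ‖g x‖ ≤ ‖embed τ u x‖ + (‖(g - embed τ z) (e * x)‖ + ‖τ (x * z * e)‖) := by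
        rw [hsplit]
        exact (norm_add_le _ _).trans (by gcongr; exact norm_add_le _ _)
    _ ≤ C * ‖x‖ + (ε / 2 * ‖x‖ + ε / 2 * ‖x‖) := by gcongr
    _ = (C + ε) * ‖x‖ := by ring

/-- The space `L_Φ` is continuously embedded in `L₁`. -/
theorem exists_enorm_le_normPhi (hτ : M.IsFaithfulNormalTracialState τ) {Φ : ℝ≥0 → ℝ≥0}
    (hΦ : IsOrliczFunction Φ) : ∃ c : ℝ≥0, 0 < c ∧ ∀ f : L1 τ, ‖f‖ₑ ≤ c * normPhi τ Φ f := by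
  obtain ⟨a, ha0, ha⟩ := hΦ.exists_linear_bound
  refine ⟨2 * a, by positivity, fun f => ?_⟩
  have hne : ((2 * a : ℝ≥0) : ℝ≥0∞) ≠ 0 := by
    rw [ENNReal.coe_ne_zero]
    positivity
  rw [mul_comm, ← ENNReal.div_le_iff_le_mul (Or.inl hne) (Or.inl ENNReal.coe_ne_top)]
  refine le_iInf₂ fun r hr => le_iInf fun hmod => ?_
  rw [ENNReal.div_le_iff_le_mul (Or.inl hne) (Or.inl ENNReal.coe_ne_top)]
  have h1 : ‖((r : ℝ) : ℂ)⁻¹ • f‖ ≤ 2 * a := by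
    refine hτ.norm_le_of_forall_bimul _ (by positivity) fun e he y hy => ?_
    refine norm_embed_le_of_modularAlg_le_one hτ.map_one hτ.map_mul_comm hΦ ha (le_trans ?_ hmod)
    exact le_iSup₂_of_le e he (le_iSup₂_of_le y hy le_rfl)
  have h2 : ‖f‖ ≤ r * (2 * a) := by
    rw [norm_smul, norm_inv, Complex.norm_real, Real.norm_of_nonneg r.coe_nonneg,
      inv_mul_le_iff₀ (by exact_mod_cast hr)] at h1
    exact h1
  rw [← ENNReal.coe_mul]
  exact enorm_le_coe.2 (by exact_mod_cast h2)

end VonNeumannAlgebra.IsFaithfulNormalTracialState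

namespace VonNeumannAlgebra.IsFaithfulNormalTracialState

open NCInt

variable {H : Type*} [NormedAddCommGroup H] [InnerProductSpace ℂ H] [CompleteSpace H]
  {M : VonNeumannAlgebra H} {τ : M.Elem →ₚ[ℂ] ℂ}

theorem dense_toL1_image (hτ : M.IsFaithfulNormalTracialState τ) {Φ : ℝ≥0 → ℝ≥0}
    (hΦ : IsOrliczFunction Φ) {𝒮 : Set M.Elem}
    (hdense : ∀ f ∈ LPhi τ Φ, ∀ ε : ℝ≥0∞, 0 < ε → ∃ x ∈ 𝒮, normPhi τ Φ (f - toL1 τ x) < ε) :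
    Dense (toL1 τ '' 𝒮) := by
  obtain ⟨c, hc0, hc⟩ := hτ.exists_enorm_le_normPhi hΦ
  intro f
  rw [Metric.mem_closure_iff]
  intro ε hε
  obtain ⟨_, ⟨z, rfl⟩, hz⟩ := Metric.mem_closure_iff.1 (L1.toDual_mem_closure f) (ε / 2)
    (by positivity)
  have hz' : ‖f - toL1 τ z‖ < ε / 2 := by
    rwa [dist_eq_norm] at hz
  obtain ⟨d, hd, hdc⟩ := ENNReal.exists_nnreal_pos_mul_lt (a := c) (b := ENNReal.ofReal (ε / 2))
    ENNReal.coe_ne_top (by simpa using hε)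
  obtain ⟨x, hx, hxd⟩ := hdense (toL1 τ z)
    (toL1_mem_LPhi hτ.map_one hτ.map_mul_comm hτ.faithful hΦ z) d (by exact_mod_cast hd)
  refine ⟨_, ⟨x, hx, rfl⟩, ?_⟩
  have h1 : ‖toL1 τ z - toL1 τ x‖ₑ < ENNReal.ofReal (ε / 2) := by
    refine (hc _).trans_lt (lt_of_le_of_lt ?_ hdc)
    rw [mul_comm]
    gcongr
  have h2 : ‖toL1 τ z - toL1 τ x‖ < ε / 2 := by
    rwa [← ofReal_norm, ENNReal.ofReal_lt_ofReal_iff (by positivity)] at h1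
  calc dist f (toL1 τ x) ≤ dist f (toL1 τ z) + dist (toL1 τ z) (toL1 τ x) := dist_triangle _ _ _
    _ < ε / 2 + ε / 2 := by
        rw [dist_eq_norm, dist_eq_norm]
        exact add_lt_add hz' h2
    _ = ε := add_halves ε

/-- A uniformly bounded sequence of operators which converges on a dense set converges pointwise
to a bounded operator. -/
theorem _root_.ContinuousLinearMap.exists_tendsto_of_dense {X : Type*} [NormedAddCommGroup X]
    [NormedSpace ℂ X] [CompleteSpace X] {S : ℕ → X →L[ℂ] X} {K : ℝ} (hS : ∀ n, ‖S n‖ ≤ K)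
    {D : Set X} (hD : Dense D) (h : ∀ x ∈ D, ∃ y, Tendsto (fun n => S n x) atTop (𝓝 y)) :
    ∃ G : X →L[ℂ] X, ∀ x, Tendsto (fun n => S n x) atTop (𝓝 (G x)) := by
  have hK : 0 ≤ K := (norm_nonneg _).trans (hS 0)
  have hcauchy : ∀ x, CauchySeq fun n => S n x := by
    intro x
    rw [Metric.cauchySeq_iff']
    intro ε hε
    obtain ⟨z, hz, hxz⟩ := Metric.mem_closure_iff.1 (hD x) (ε / 3 / (K + 1)) (by positivity)
    obtain ⟨y, hy⟩ := h z hz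
    obtain ⟨N, hN⟩ := Metric.cauchySeq_iff'.1 hy.cauchySeq (ε / 3) (by positivity)
    refine ⟨N, fun n hn => ?_⟩
    have h1 : ∀ m, dist (S m x) (S m z) < ε / 3 := by
      intro m
      rw [lt_div_iff₀ (by positivity)] at hxz
      rw [dist_eq_norm] at hxz ⊢
      rw [← map_sub]
      have := (S m).le_of_opNorm_le (hS m) (x - z)
      rcases (norm_nonneg (x - z)).eq_or_lt with h0 | h0
      · rw [← h0, mul_zero] at this
        linarith
      · nlinarith
    have h2 := dist_triangle4 (S n x) (S n z) (S N z) (S N x)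
    have h3 := h1 N
    rw [dist_comm] at h3
    linarith [h1 n, hN n hn]
  choose G hG using fun x => cauchySeq_tendsto_of_complete (hcauchy x)
  exact ⟨continuousLinearMapOfTendsto S (tendsto_pi_nhds.2 hG), hG⟩

instance _root_.NCInt.completeSpace_L1 (τ : M.Elem →ₚ[ℂ] ℂ) : CompleteSpace (L1 τ) :=
  (Submodule.isClosed_topologicalClosure _).completeSpace_coe

theorem existsUnique_extension (hτ : M.IsFaithfulNormalTracialState τ)
    {S : ℕ → L1 τ →L[ℂ] L1 τ} (hS : ∃ K : ℝ, ∀ n, ‖S n‖ ≤ K) {F : M.Elem → M.Elem}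
    {𝒮 : Set M.Elem} (hD : Dense (toL1 τ '' 𝒮))
    (hconv : ∀ x ∈ 𝒮, Tendsto
      (fun n => normInf τ (L1.toDual τ (S n (toL1 τ x) - toL1 τ (F x)))) atTop (𝓝 0)) :
    ∃! G : L1 τ →L[ℂ] L1 τ, ∀ x ∈ 𝒮, G (toL1 τ x) = toL1 τ (F x) := by
  obtain ⟨K, hK⟩ := hS
  have hlim : ∀ x ∈ 𝒮, Tendsto (fun n => S n (toL1 τ x)) atTop (𝓝 (toL1 τ (F x))) := by
    intro x hx
    rw [tendsto_iff_edist_tendsto_0]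
    refine tendsto_of_tendsto_of_tendsto_of_le_of_le tendsto_const_nhds (hconv x hx)
      (fun _ => zero_le) fun n => ?_
    refine le_trans (le_of_eq ?_) (enorm_le_normInf hτ.map_one _)
    rw [edist_eq_enorm_sub, (L1.toDual τ).enorm_map]
  obtain ⟨G, hG⟩ := ContinuousLinearMap.exists_tendsto_of_dense hK hD (by
    rintro _ ⟨x, hx, rfl⟩
    exact ⟨_, hlim x hx⟩)
  refine ⟨G, fun x hx => tendsto_nhds_unique (hG _) (hlim x hx), fun G' hG' => ?_⟩
  refine DFunLike.coe_injective (Continuous.ext_on hD G'.continuous G.continuous ?_)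
  rintro _ ⟨x, hx, rfl⟩
  exact (hG' x hx).trans (tendsto_nhds_unique (hlim x hx) (hG _))

theorem exists_projection_of_limsupNorm_lt (hτ : M.IsFaithfulNormalTracialState τ)
    {f : ℕ → StrongDual ℂ M.Elem} {δ : ℝ≥0} (hf : limsupNorm τ f < δ) {ε c : ℝ} (hε : 0 < ε)
    (hc : 0 < c) : ∃ p : M.Elem, IsStarProjection p ∧ (τ p).re ≤ ε + 4 * (4 / c) ^ 2 ∧
      ∀ᶠ n in atTop, normInf τ (corner p (f n)) ≤ ENNReal.ofReal (c ^ 2 * δ) := by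
  have h1 := (le_iSup₂ (f := fun (ε : ℝ) (_ : 0 < ε) => ⨅ (e : M.Elem) (_ : IsStarProjection e)
    (_ : (τ e).re < ε) (N : ℕ), normL1linf τ (fun k => corner e (f (N + 1 + k)))) ε hε).trans_lt hf
  simp only [iInf_lt_iff] at h1
  obtain ⟨e, he, hle, N, hN⟩ := h1
  obtain ⟨p, hp, hple, hpn⟩ := hτ.exists_projection_normInf_corner_le_of_normL1linf_lt hN hc
  obtain ⟨q, hq, heq, hpq, hqle⟩ := hτ.exists_projection_sup₂ he hp
  refine ⟨q, hq, by linarith, ?_⟩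
  filter_upwards [eventually_ge_atTop (N + 1)] with n hn
  obtain ⟨k, rfl⟩ := Nat.exists_eq_add_of_le hn
  rw [← corner_corner he hq heq]
  exact (normInf_corner_le_of_le hτ.map_mul_comm hp hq hpq _).trans (hpn k)

theorem exists_approximation (hτ : M.IsFaithfulNormalTracialState τ) {Φ : ℝ≥0 → ℝ≥0}
    (hΦ : IsOrliczFunction Φ) {𝒮 : Set M.Elem}
    (hdense : ∀ f ∈ LPhi τ Φ, ∀ ε : ℝ≥0∞, 0 < ε → ∃ x ∈ 𝒮, normPhi τ Φ (f - toL1 τ x) < ε)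
    {S : ℕ → L1 τ →L[ℂ] L1 τ} {C : ℝ≥0}
    (hC : ∀ f ∈ LPhi τ Φ, limsupNorm τ (fun n => L1.toDual τ (S n f)) ≤ C * normPhi τ Φ f)
    (G : L1 τ →L[ℂ] L1 τ) {f : L1 τ} (hf : f ∈ LPhi τ Φ) {ε r : ℝ} (hε : 0 < ε) (hr : 0 < r) :
    ∃ x ∈ 𝒮, ∃ p : M.Elem, IsStarProjection p ∧ (τ p).re ≤ ε ∧
      (∀ᶠ n in atTop,
        normInf τ (corner p (L1.toDual τ (S n (f - toL1 τ x)))) ≤ ENNReal.ofReal r) ∧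
      normInf τ (corner p (L1.toDual τ (G (f - toL1 τ x)))) ≤ ENNReal.ofReal r := by
  obtain ⟨a, ha0, ha⟩ := hτ.exists_enorm_le_normPhi hΦ
  set c : ℝ := √(4 * 16 * 3 / ε)
  have hc : 0 < c := by positivity
  have hc2 : c ^ 2 = 4 * 16 * 3 / ε := Real.sq_sqrt (by positivity)
  set δ : ℝ≥0 := (r / c ^ 2).toNNReal
  have hδ : (δ : ℝ) = r / c ^ 2 := Real.coe_toNNReal _ (by positivity)
  have hδ0 : 0 < δ := by
    rw [← NNReal.coe_pos, hδ]
    positivity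
  set η : ℝ := r * (ε / 3) / 8
  have hη : 0 < η := by positivity
  obtain ⟨d, hd, hdlt⟩ := ENNReal.exists_nnreal_pos_mul_lt (a := C + ‖G‖ₑ * a)
    (b := min δ (ENNReal.ofReal η)) (by finiteness)
    (lt_min (by exact_mod_cast hδ0) (by simpa using hη)).ne'
  obtain ⟨x, hx, hxd⟩ := hdense f hf d (by exact_mod_cast hd)
  have hmem : f - toL1 τ x ∈ LPhi τ Φ := by
    have h1 := hxd.trans (ENNReal.coe_lt_top (r := d))
    simp only [normPhi, iInf_lt_iff] at h1
    obtain ⟨s, hs, hmod, -⟩ := h1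
    exact ⟨s, hs, hmod.trans_lt ENNReal.one_lt_top⟩
  have hlim : limsupNorm τ (fun n => L1.toDual τ (S n (f - toL1 τ x))) < δ := by
    refine (hC _ hmem).trans_lt (lt_of_le_of_lt ?_ (hdlt.trans_le (min_le_left _ _)))
    rw [mul_comm]
    gcongr
    exact le_self_add
  have hGn : ‖G (f - toL1 τ x)‖ < η := by
    have h1 : ‖G (f - toL1 τ x)‖ₑ < ENNReal.ofReal η := by
      refine lt_of_le_of_lt ?_ (hdlt.trans_le (min_le_right _ _))
      calc ‖G (f - toL1 τ x)‖ₑ ≤ ‖G‖ₑ * ‖f - toL1 τ x‖ₑ := G.le_opENorm _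
        _ ≤ ‖G‖ₑ * (a * d) := by
            gcongr
            exact (ha _).trans (by gcongr)
        _ = d * (‖G‖ₑ * a) := by ring
        _ ≤ d * (C + ‖G‖ₑ * a) := by
            gcongr
            exact le_add_self
    rwa [← ofReal_norm, ENNReal.ofReal_lt_ofReal_iff hη] at h1
  obtain ⟨p₁, hp₁, hle₁, hev⟩ := hτ.exists_projection_of_limsupNorm_lt hlim
    (ε := ε / 3) (by positivity) hc
  obtain ⟨p₂, hp₂, hle₂, hG⟩ := hτ.exists_projection_normInf_corner_le _ hGn hr
  obtain ⟨p, hp, h1p, h2p, hple⟩ := hτ.exists_projection_sup₂ hp₁ hp₂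
  refine ⟨x, hx, p, hp, ?_, ?_, ?_⟩
  · have h1 : 4 * (4 / c) ^ 2 = ε / 3 := by
      rw [div_pow, hc2]
      field_simp
      norm_num
    have h2 : 8 * η / r = ε / 3 := by
      simp only [η]
      field_simp
    linarith
  · filter_upwards [hev] with n hn
    refine (normInf_corner_le_of_le hτ.map_mul_comm hp₁ hp h1p _).trans (hn.trans (le_of_eq ?_))
    rw [hδ, mul_div_cancel₀ _ (by positivity)]
  · exact (normInf_corner_le_of_le hτ.map_mul_comm hp₂ hp h2p _).trans hG

theorem tendstoBAU (hτ : M.IsFaithfulNormalTracialState τ) {Φ : ℝ≥0 → ℝ≥0}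
    (hΦ : IsOrliczFunction Φ) {𝒮 : Set M.Elem}
    (hdense : ∀ f ∈ LPhi τ Φ, ∀ ε : ℝ≥0∞, 0 < ε → ∃ x ∈ 𝒮, normPhi τ Φ (f - toL1 τ x) < ε)
    {S : ℕ → L1 τ →L[ℂ] L1 τ} {C : ℝ≥0}
    (hC : ∀ f ∈ LPhi τ Φ, limsupNorm τ (fun n => L1.toDual τ (S n f)) ≤ C * normPhi τ Φ f)
    {G : L1 τ →L[ℂ] L1 τ} (hG : ∀ x ∈ 𝒮, Tendsto
      (fun n => normInf τ (L1.toDual τ (S n (toL1 τ x) - G (toL1 τ x)))) atTop (𝓝 0))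
    {f : L1 τ} (hf : f ∈ LPhi τ Φ) :
    TendstoBAU τ (fun n => L1.toDual τ (S n f)) (L1.toDual τ (G f)) := by
  intro ε hε
  choose x hx p hp hple hpS hpG using fun k : ℕ => hτ.exists_approximation hΦ hdense hC G hf
    (ε := ε / 4 * (1 / 2) ^ k) (r := 1 / ((k : ℝ) + 1)) (by positivity) (by positivity)
  obtain ⟨e, he, hpe, hle⟩ := hτ.exists_projection_sup hp
    (hasSum_geometric_two.mul_left (ε / 4)) hple
  refine ⟨e, he, by linarith, ?_⟩
  rw [ENNReal.tendsto_nhds_zero]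
  intro t ht
  obtain ⟨k, hk⟩ : ∃ k : ℕ, ENNReal.ofReal (1 / ((k : ℝ) + 1)) < t / 3 := by
    have h1 : Tendsto (fun k : ℕ => ENNReal.ofReal (1 / ((k : ℝ) + 1))) atTop (𝓝 0) := by
      rw [← ENNReal.ofReal_zero]
      exact ENNReal.tendsto_ofReal tendsto_one_div_add_atTop_nhds_zero_nat
    exact (h1.eventually_lt_const (ENNReal.div_pos ht.ne' (by simp))).exists
  have h2 := (ENNReal.tendsto_nhds_zero.1 (hG (x k) (hx k))) (t / 3)
    (ENNReal.div_pos ht.ne' (by simp))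
  filter_upwards [h2, hpS k] with n hn hSn
  have hsplit : L1.toDual τ (S n f) - L1.toDual τ (G f) =
      L1.toDual τ (S n (f - toL1 τ (x k))) + L1.toDual τ (G (toL1 τ (x k) - f)) +
        L1.toDual τ (S n (toL1 τ (x k)) - G (toL1 τ (x k))) := by
    simp only [map_sub]
    abel
  have hneg : normInf τ (corner e (L1.toDual τ (G (toL1 τ (x k) - f)))) ≤ t / 3 := by
    have h3 : corner e (L1.toDual τ (G (toL1 τ (x k) - f))) =
        bimul (-1) (corner e (L1.toDual τ (G (f - toL1 τ (x k))))) 1 := by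
      ext y
      rw [← neg_sub f, map_neg, map_neg]
      simp only [corner, bimul_apply, one_mul, mul_neg, mul_one, map_neg]
      rfl
    rw [h3]
    refine (normInf_bimul_le hτ.map_mul_comm ?_ ?_ _).trans
      (((normInf_corner_le_of_le hτ.map_mul_comm (hp k) he (hpe k) _).trans (hpG k)).trans hk.le)
    · rw [norm_neg]
      exact (IsStarProjection.one _).norm_le_one
    · exact (IsStarProjection.one _).norm_le_one
  rw [hsplit, corner_add, corner_add]
  calc _ ≤ t / 3 + t / 3 + t / 3 := by
        refine (normInf_add_le τ _ _).trans (add_le_add ((normInf_add_le τ _ _).trans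
          (add_le_add ?_ hneg)) ((normInf_corner_le hτ.map_mul_comm he _).trans hn))
        exact ((normInf_corner_le_of_le hτ.map_mul_comm (hp k) he (hpe k) _).trans hSn).trans hk.le
    _ = t := ENNReal.add_thirds t

end VonNeumannAlgebra.IsFaithfulNormalTracialState

theorem mainTheorem8 {H : Type*} [NormedAddCommGroup H] [InnerProductSpace ℂ H] [CompleteSpace H]
    (M : VonNeumannAlgebra H) (τ : M.Elem →ₚ[ℂ] ℂ) (hτ : M.IsFaithfulNormalTracialState τ)
    (Φ : ℝ≥0 → ℝ≥0) (hΦ : NCInt.IsOrliczFunction Φ)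
    (S : ℕ → NCInt.L1 τ →L[ℂ] NCInt.L1 τ) (hS : ∃ K : ℝ, ∀ n, ‖S n‖ ≤ K)
    (F : M.Elem →L[ℂ] M.Elem) (hF : M.IsNormalMap F)
    (𝒮 : Set M.Elem)
    (hdense : ∀ f ∈ NCInt.LPhi τ Φ, ∀ ε : ℝ≥0∞, 0 < ε →
      ∃ x ∈ 𝒮, NCInt.normPhi τ Φ (f - NCInt.toL1 τ x) < ε)
    (hconv : ∀ x ∈ 𝒮, Tendsto
      (fun n => NCInt.normInf τ (NCInt.L1.toDual τ (S n (NCInt.toL1 τ x) - NCInt.toL1 τ (F x))))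
      atTop (𝓝 0))
    (hlimsup : ∃ C : ℝ≥0, ∀ f ∈ NCInt.LPhi τ Φ,
      NCInt.limsupNorm τ (fun n => NCInt.L1.toDual τ (S n f)) ≤ C * NCInt.normPhi τ Φ f) :
    (∃! G : NCInt.L1 τ →L[ℂ] NCInt.L1 τ, ∀ x ∈ 𝒮, G (NCInt.toL1 τ x) = NCInt.toL1 τ (F x)) ∧
    ∀ G : NCInt.L1 τ →L[ℂ] NCInt.L1 τ, (∀ x ∈ 𝒮, G (NCInt.toL1 τ x) = NCInt.toL1 τ (F x)) →
      ∀ f ∈ NCInt.LPhi τ Φ,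
        NCInt.TendstoBAU τ (fun n => NCInt.L1.toDual τ (S n f)) (NCInt.L1.toDual τ (G f)) := by
  obtain ⟨C, hC⟩ := hlimsup
  refine ⟨hτ.existsUnique_extension hS (hτ.dense_toL1_image hΦ hdense) hconv,
    fun G hG f hf => hτ.tendstoBAU hΦ hdense hC (fun x hx => ?_) hf⟩
  simpa only [hG x hx] using hconv x hx
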